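/- Let $S^1=\mathbb R/\mathbb Z$ and let $f:S^1\times\mathbb R\to\mathbb R$ be smooth and proper, with $\lim_{x\to+\infty}f(t,x)=\lim_{x\to-\infty}f(t,x)=+\infty$ for every $t\in S^1$, and with $D_2^2f(t,x)>0$ for all $(t,x)$, where $D_2$ is the partial derivative in the second variable. Let $(B^1,B^0)$ be either of the pairs of real Banach spaces $(C^1(S^1),C^0(S^1))$ or $(H^1(S^1),L^2(S^1))$ of real-valued functions, where $H^1(S^1)$ is the space of absolutely continuous functions on $S^1$ with derivative in $L^2$. Let $\tilde B^0=\{v\in B^0:\int_{S^1}v=0\}$, and let $F:B^1\to B^0$ be the operator $F(u)(t)=u'(t)+f(t,u(t))$. Then, in both cases, $F$ is a global fold: there are ($C^\infty$) diffeomorphisms $\Xi_1:B^1\to\mathbb R\times\tilde B^0$ and $\Xi_0:B^0\to\mathbb R\times\tilde B^0$ such that $$(\Xi_0\circ F\circ\Xi_1^{-1})(x,\tilde v)=(x^2,\tilde v)\qquad\text{for all }(x,\tilde v)\in\mathbb R\times\tilde B^0 .$$ -/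

import Mathlib

open MeasureTheory Filter Topology
open scoped Manifold ContDiff

noncomputable section

namespace PeriodicODE

/-! The circle is `UnitAddCircle = ℝ / ℤ`, whose `volume` has total mass one. -/

/-- Smoothness of a function on the cylinder: its lift to `ℝ × ℝ`, one-periodic in the first
variable, is smooth. -/
def SmoothOnCylinder (f : UnitAddCircle × ℝ → ℝ) : Prop :=
  ContDiff ℝ ∞ (fun p : ℝ × ℝ => f ((p.1 : UnitAddCircle), p.2))

/-- The second partial derivative in the second variable. -/
def D₂D₂ (f : UnitAddCircle × ℝ → ℝ) (t : UnitAddCircle) (x : ℝ) : ℝ :=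
  iteratedDeriv 2 (fun y => f (t, y)) x

/-! ### Spaces of continuous functions -/

/-- `C⁰(S¹)` with the supremum norm. -/
abbrev C0 : Type := C(UnitAddCircle, ℝ)

/-- `C¹(S¹)`, a function `u` being recorded as the pair `(u, u')`; the norm is the `C¹` norm
`max ‖u‖_∞ ‖u'‖_∞`. -/
def C1 : Submodule ℝ (C0 × C0) where
  carrier := {p | ∀ t : ℝ, HasDerivAt (fun s : ℝ => p.1 (s : UnitAddCircle)) (p.2 t) t}
  add_mem' hp hq t := (hp t).add (hq t)
  zero_mem' t := hasDerivAt_const t (0 : ℝ)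
  smul_mem' c _ hp t := (hp t).const_mul c

/-- Continuous functions of average zero. -/
def C0Tilde : Submodule ℝ C0 where
  carrier := {v | ∫ t, v t = 0}
  add_mem' {v w} hv hw := by
    have hiv : Integrable v := v.continuous.integrable_of_hasCompactSupport
      (HasCompactSupport.of_compactSpace _)
    have hiw : Integrable w := w.continuous.integrable_of_hasCompactSupport
      (HasCompactSupport.of_compactSpace _)
    simp only [Set.mem_ofPred_eq] at hv hw ⊢
    simp [integral_add hiv hiw, hv, hw]
  zero_mem' := by simp
  smul_mem' c v hv := by
    simp only [Set.mem_ofPred_eq] at hv ⊢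
    simp [integral_const_mul, hv]

/-- The operator `u ↦ u' + f(t, u(t))` from `C¹(S¹)` to `C⁰(S¹)`. -/
def opC (f : C(UnitAddCircle × ℝ, ℝ)) (u : C1) : C0 :=
  u.1.2 + f.comp ((ContinuousMap.id UnitAddCircle).prodMk u.1.1)

/-! ### Hilbert spaces -/

/-- `H⁰(S¹) = L²(S¹)`. -/
abbrev H0 : Type := Lp ℝ 2 (volume : Measure UnitAddCircle)

lemma H0.intervalIntegrable (w : H0) {x : ℝ} (hx : x ∈ Set.Icc (0 : ℝ) 1) :
    IntervalIntegrable (fun s : ℝ => w (s : UnitAddCircle)) volume 0 x := by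
  have h1 : Integrable w := (Lp.memLp w).integrable (by norm_num)
  have h2 := (UnitAddCircle.measurePreserving_mk 0).integrable_comp_of_integrable h1
  rw [intervalIntegrable_iff_integrableOn_Ioc_of_le hx.1]
  refine IntegrableOn.mono_set h2 (Set.Ioc_subset_Ioc_right ?_)
  simpa using hx.2

lemma H0.integral_congr {g h : UnitAddCircle → ℝ} (e : g =ᵐ[volume] h) {x : ℝ}
    (hx : x ∈ Set.Icc (0 : ℝ) 1) :
    ∫ s in (0 : ℝ)..x, g (s : UnitAddCircle) = ∫ s in (0 : ℝ)..x, h (s : UnitAddCircle) := by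
  have h2 := (UnitAddCircle.measurePreserving_mk 0).quasiMeasurePreserving.ae_eq_comp e
  rw [intervalIntegral.integral_of_le hx.1, intervalIntegral.integral_of_le hx.1]
  refine integral_congr_ae (ae_mono (Measure.restrict_mono_set _ ?_) h2)
  exact Set.Ioc_subset_Ioc_right (by simpa using hx.2)

/-- `H¹(S¹)`, with its Hilbert space structure `⟨u, v⟩ = ⟨u, v⟩_{L²} + ⟨u', v'⟩_{L²}`. A function `u`
is recorded as the pair `(u, u')` of elements of `L²`; membership says that `u` has a
representative `U` on the circle that is absolutely continuous with derivative `u'`, that is,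
`U` is continuous and `U x = U 0 + ∫₀ˣ u'`. -/
def H1 : Submodule ℝ (WithLp 2 (H0 × H0)) where
  carrier := {p | ∃ U : C(UnitAddCircle, ℝ), p.fst =ᵐ[volume] U ∧
    ∀ x ∈ Set.Icc (0 : ℝ) 1,
      U (x : UnitAddCircle) = U ((0 : ℝ) : UnitAddCircle)
        + ∫ s in (0 : ℝ)..x, p.snd (s : UnitAddCircle)}
  add_mem' := by
    rintro p q ⟨U, hU, hU'⟩ ⟨V, hV, hV'⟩
    refine ⟨U + V, ?_, fun x hx => ?_⟩
    · rw [WithLp.add_fst]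
      filter_upwards [Lp.coeFn_add p.fst q.fst, hU, hV] with t h1 h2 h3
      rw [h1, Pi.add_apply, h2, h3, ContinuousMap.add_apply]
    · rw [WithLp.add_snd, H0.integral_congr (Lp.coeFn_add p.snd q.snd) hx]
      simp only [Pi.add_apply, ContinuousMap.add_apply]
      rw [intervalIntegral.integral_add (H0.intervalIntegrable _ hx) (H0.intervalIntegrable _ hx),
        hU' x hx, hV' x hx]
      ring
  zero_mem' := by
    refine ⟨0, ?_, fun x hx => ?_⟩
    · exact Lp.coeFn_zero ℝ 2 volume
    · rw [WithLp.zero_snd, H0.integral_congr (Lp.coeFn_zero ℝ 2 volume) hx]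
      simp
  smul_mem' := by
    rintro c p ⟨U, hU, hU'⟩
    refine ⟨c • U, ?_, fun x hx => ?_⟩
    · rw [WithLp.smul_fst]
      filter_upwards [Lp.coeFn_smul c p.fst, hU] with t h1 h2
      simp [h1, h2]
    · rw [WithLp.smul_snd, H0.integral_congr (Lp.coeFn_smul c p.snd) hx]
      simp only [Pi.smul_apply, ContinuousMap.smul_apply, smul_eq_mul]
      rw [intervalIntegral.integral_const_mul, hU' x hx]
      ring

/-- Square integrable functions of average zero. -/
def H0Tilde : Submodule ℝ H0 where
  carrier := {v | ∫ t, v t = 0}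
  add_mem' {v w} hv hw := by
    have hiv : Integrable v := (Lp.memLp v).integrable (by norm_num)
    have hiw : Integrable w := (Lp.memLp w).integrable (by norm_num)
    simp only [Set.mem_ofPred_eq] at hv hw ⊢
    rw [integral_congr_ae (Lp.coeFn_add v w)]
    simp [integral_add hiv hiw, hv, hw]
  zero_mem' := by
    simp only [Set.mem_ofPred_eq]
    rw [integral_congr_ae (Lp.coeFn_zero ℝ 2 volume)]
    simp
  smul_mem' c v hv := by
    simp only [Set.mem_ofPred_eq] at hv ⊢
    rw [integral_congr_ae (Lp.coeFn_smul c v)]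
    simp [integral_const_mul, hv]

lemma H1.memLp_comp (f : C(UnitAddCircle × ℝ, ℝ)) (u : H1) :
    MemLp (fun t : UnitAddCircle => f (t, u.1.fst t)) 2 volume := by
  obtain ⟨U, hU, -⟩ := u.2
  have hc : MemLp (f.comp ((ContinuousMap.id UnitAddCircle).prodMk U)) 2
      (volume : Measure UnitAddCircle) :=
    (ContinuousMap.continuous _).memLp_of_hasCompactSupport (HasCompactSupport.of_compactSpace _)
  refine hc.ae_eq ?_
  filter_upwards [hU] with t ht
  simp [ht]

/-- The operator `u ↦ u' + f(t, u(t))` from `H¹(S¹)` to `L²(S¹)`. -/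
def opH (f : C(UnitAddCircle × ℝ, ℝ)) (u : H1) : H0 :=
  u.1.snd + (H1.memLp_comp f u).toLp (fun t : UnitAddCircle => f (t, u.1.fst t))

/-! ### Global folds -/

/-- `G : B₁ → B₀` is a global fold (with respect to the subspace `Z` of `B₀`): smooth
diffeomorphisms of `B₁` and of `B₀` onto `ℝ × Z` conjugate `G` to `(x, v) ↦ (x², v)`. -/
def IsGlobalFold {B₁ B₀ : Type*} [NormedAddCommGroup B₁] [NormedSpace ℝ B₁]
    [NormedAddCommGroup B₀] [NormedSpace ℝ B₀] (Z : Submodule ℝ B₀) (G : B₁ → B₀) : Prop :=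
  ∃ (Ξ₁ : B₁ ≃ₘ[ℝ] (ℝ × Z)) (Ξ₀ : B₀ ≃ₘ[ℝ] (ℝ × Z)),
    ∀ (x : ℝ) (v : Z), Ξ₀ (G (Ξ₁.symm (x, v))) = (x ^ 2, v)

end PeriodicODE

end

open MeasureTheory Filter Topology
open scoped Manifold ContDiff

noncomputable section

namespace PeriodicODE

/-! ### Integrals depending smoothly on a parameter -/

/-! Let `Q` send a function to the primitive, vanishing at `0`, of its mean free part, and let `N u
= f(·, u)`. Use the linear coordinates (value at `0`, derivative) on `B¹` and (mean, mean free part)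
on `B⁰`. The operator becomes `(s, z) ↦ (mean N(u), z + (mean free part of N(u)))` with `u = s + Q
z`. If `w` denotes the second component, applying `s + Q ·` gives `u + Q N(u) = s + Q w`, an
equation in `C⁰` in both cases. All the analysis therefore takes place on `C⁰`, and the two pairs of
spaces differ only in their coordinates (`isGlobalFold_of_coordinates`).

The map `straighten f = id + Q N` is a diffeomorphism of `C⁰`. It is injective with invertible
derivative because a function vanishing at both ends of a period cannot cross zero always in the
same direction (`eq_zero_of_eq_neg_meanPrimitive`), combined with the Fredholm alternative. It is
onto because its range is open and, by coercivity and compactness of `Q`, closed. Changing variables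
by it turns the operator into `(s, w) ↦ (height(s, Q w), w)`.

On each line `s ↦ height(s, e)` tends to infinity at both ends and has positive second derivative.
The second derivative of `u` in `s` solves a linear equation with zero values at `0` and `1`, and an
integrating factor together with `D₂²f > 0` forces the sign (`exists_height_derivs`). A Morse lemma
with parameters (`exists_fold_coordinate`) then writes `height = ξ² + m`. Taking `ξ` as coordinate
in the domain and subtracting `m` in the target leaves the fold. -/

theorem hasFDerivAt_unitInterval_integral {E F : Type} [NormedAddCommGroup E] [NormedSpace ℝ E]
    [NormedAddCommGroup F] [NormedSpace ℝ F] {G : E × ℝ → F} (hG : ContDiff ℝ 1 G) (e : E) :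
    HasFDerivAt (fun e => ∫ τ in (0 : ℝ)..1, G (e, τ))
      (∫ τ in (0 : ℝ)..1, (fderiv ℝ G (e, τ)).comp (ContinuousLinearMap.inl ℝ E ℝ)) e := by
  have hG' : Continuous fun p : E × ℝ =>
      (fderiv ℝ G p).comp (ContinuousLinearMap.inl ℝ E ℝ) :=
    (hG.continuous_fderiv one_ne_zero).clm_comp continuous_const
  have hcurve (x : E) : Continuous fun τ : ℝ => (x, τ) := by fun_prop
  obtain ⟨M, hM⟩ := (isCompact_Icc (a := (0 : ℝ)) (b := 1)).exists_bound_of_continuousOn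
    (hG'.comp (hcurve e)).continuousOn
  -- `E` need not be locally compact, so the bound uniform near `e` comes from compactness of `[0,
  -- 1]` alone.
  obtain ⟨u, v, hu, -, heu, hv, huv⟩ := generalized_tube_lemma (isCompact_singleton (x := e))
    (isCompact_Icc (a := (0 : ℝ)) (b := 1))
    (isOpen_lt hG'.norm (continuous_const (y := M + 1))) (by
      rintro ⟨x, τ⟩ ⟨hx, hτ⟩
      obtain rfl : x = e := hx
      exact (hM τ hτ).trans_lt (lt_add_one M))
  refine intervalIntegral.hasFDerivAt_integral_of_dominated_of_fderiv_le
    (F' := fun x τ => (fderiv ℝ G (x, τ)).comp (ContinuousLinearMap.inl ℝ E ℝ))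
    (bound := fun _ => M + 1) (hu.mem_nhds (heu rfl)) ?_ ?_ ?_ ?_ ?_ ?_
  · exact Eventually.of_forall fun x => (hG.continuous.comp (hcurve x)).aestronglyMeasurable
  · exact (hG.continuous.comp (hcurve e)).intervalIntegrable _ _
  · exact (hG'.comp (hcurve e)).aestronglyMeasurable
  · refine Eventually.of_forall fun τ hτ x hx => ?_
    rw [Set.uIoc_of_le zero_le_one] at hτ
    exact (show _ < _ from huv ⟨hx, hv (Set.Ioc_subset_Icc_self hτ)⟩).le
  · exact intervalIntegrable_const
  · refine Eventually.of_forall fun τ _ x _ => ?_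
    exact ((hG.differentiable one_ne_zero (x, τ)).hasFDerivAt).comp x
      (hasFDerivAt_prodMk_left x τ)

/-- The derivative is an integral of the same kind with values in `E →L[ℝ] F`, so the induction on
the order must let `F` vary. -/
theorem contDiff_unitInterval_integral {E : Type} [NormedAddCommGroup E] [NormedSpace ℝ E]
    {F : Type} [NormedAddCommGroup F] [NormedSpace ℝ F] {G : E × ℝ → F} (hG : ContDiff ℝ ∞ G) :
    ContDiff ℝ ∞ fun e => ∫ τ in (0 : ℝ)..1, G (e, τ) := by
  refine contDiff_infty.2 fun n => ?_
  induction n generalizing F with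
  | zero =>
    exact contDiff_zero.2 (continuous_iff_continuousAt.2 fun e =>
      (hasFDerivAt_unitInterval_integral (hG.of_le (mod_cast le_top)) e).continuousAt)
  | succ n ih =>
    refine contDiff_succ_iff_hasFDerivAt.2 ⟨_, ?_,
      hasFDerivAt_unitInterval_integral (hG.of_le (mod_cast le_top))⟩
    exact ih (G := fun p => (fderiv ℝ G p).comp (ContinuousLinearMap.inl ℝ E ℝ))
      ((hG.fderiv_right (m := ∞) (by simp)).clm_comp contDiff_const)

/-! ### Normal form of a coercive function which is strictly convex in one variable -/

section Fold

variable {E : Type} [NormedAddCommGroup E] [NormedSpace ℝ E]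

theorem hasDerivAt_fst_slice {c : ℝ × E → ℝ} {s : ℝ} {e : E} (hc : DifferentiableAt ℝ c (s, e)) :
    HasDerivAt (fun s => c (s, e)) (fderiv ℝ c (s, e) (1, 0)) s := by
  have h := hc.hasFDerivAt.comp_hasDerivAt s ((hasDerivAt_id s).prodMk (hasDerivAt_const s e))
  exact h

theorem contDiff_fst_deriv {c c₁ : ℝ × E → ℝ} (hc : ContDiff ℝ ∞ c)
    (h : ∀ s e, HasDerivAt (fun s => c (s, e)) (c₁ (s, e)) s) : ContDiff ℝ ∞ c₁ := by
  have : c₁ = fun p => fderiv ℝ c p (1, 0) := by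
    ext ⟨s, e⟩
    exact (h s e).unique (hasDerivAt_fst_slice (hc.differentiable (by simp) _))
  rw [this]
  exact (hc.fderiv_right (m := ∞) (by simp)).clm_apply contDiff_const

/-- Zeros of a smooth function increasing in its first variable depend smoothly on the second. -/
theorem contDiff_of_forall_eq_zero [CompleteSpace E] {g g₁ : ℝ × E → ℝ} (hg : ContDiff ℝ ∞ g)
    (h : ∀ s e, HasDerivAt (fun s => g (s, e)) (g₁ (s, e)) s) (hpos : ∀ s e, 0 < g₁ (s, e))
    {σ : E → ℝ} (hσ : ∀ e, g (σ e, e) = 0) : ContDiff ℝ ∞ σ := by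
  have hmono (e : E) : StrictMono fun s => g (s, e) :=
    strictMono_of_deriv_pos fun s => by rw [(h s e).deriv]; exact hpos s e
  refine contDiff_iff_contDiffAt.2 fun e => ?_
  have hf : ContDiff ℝ ∞ fun p : E × ℝ => g (p.2, p.1) :=
    hg.comp (contDiff_snd.prodMk contDiff_fst)
  have hf' : HasDerivAt (fun s => g (s, e))
      ((fderiv ℝ (fun p : E × ℝ => g (p.2, p.1)) (e, σ e)) (0, 1)) (σ e) :=
    (hf.differentiable (by simp) (e, σ e)).hasFDerivAt.comp_hasDerivAt (σ e)
      ((hasDerivAt_const (σ e) e).prodMk (hasDerivAt_id (σ e)))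
  have hinv : ((fderiv ℝ (fun p : E × ℝ => g (p.2, p.1)) (e, σ e)) ∘L
      ContinuousLinearMap.inr ℝ E ℝ).IsInvertible := by
    refine ⟨ContinuousLinearEquiv.unitsEquivAut ℝ
      (Units.mk0 (g₁ (σ e, e)) (hpos _ _).ne'), ?_⟩
    ext
    simp [← hf'.unique (h _ _)]
  have hfe := hf.contDiffAt (x := (e, σ e))
  have hsm := hfe.contDiffAt_implicitFunction (by simp) hinv
  refine hsm.congr_of_eventuallyEq ?_
  filter_upwards [hfe.eventually_apply_implicitFunction (by simp) hinv] with x hx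
  -- Strict monotonicity makes the zero unique, which identifies `σ` with the implicit function
  -- without knowing beforehand that `σ` is continuous.
  refine (hmono x).injective ?_
  simp only [hσ] at hx ⊢
  exact hx.symm

/-- Morse lemma with parameters, made global by convexity. Around the unique critical point `s₀ e`,
Taylor's formula gives `c = (s - s₀)² q + c(s₀)` with `q > 0` smooth, and `ξ = (s - s₀) √q`. -/
theorem exists_fold_coordinate [CompleteSpace E] {c c₁ c₂ : ℝ × E → ℝ} (hc : ContDiff ℝ ∞ c)
    (h₁ : ∀ s e, HasDerivAt (fun s => c (s, e)) (c₁ (s, e)) s)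
    (h₂ : ∀ s e, HasDerivAt (fun s => c₁ (s, e)) (c₂ (s, e)) s)
    (hpos : ∀ s e, 0 < c₂ (s, e))
    (htop : ∀ e, Tendsto (fun s => c (s, e)) atTop atTop)
    (hbot : ∀ e, Tendsto (fun s => c (s, e)) atBot atTop) :
    ∃ (m : E → ℝ) (ξ σ : ℝ × E → ℝ), ContDiff ℝ ∞ m ∧ ContDiff ℝ ∞ ξ ∧ ContDiff ℝ ∞ σ ∧
      (∀ s e, σ (ξ (s, e), e) = s) ∧ (∀ x e, ξ (σ (x, e), e) = x) ∧
      ∀ s e, c (s, e) = ξ (s, e) ^ 2 + m e := by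
  have hc₁ := contDiff_fst_deriv hc h₁
  have hc₂ := contDiff_fst_deriv hc₁ h₂
  have hmono (e : E) : StrictMono fun s => c₁ (s, e) :=
    strictMono_of_deriv_pos fun s => by rw [(h₂ s e).deriv]; exact hpos s e
  have hcrit (e : E) : ∃ s, c₁ (s, e) = 0 := by
    have hcont : Continuous fun s => c (s, e) := hc.continuous.comp (by fun_prop)
    obtain ⟨s, hs⟩ := hcont.exists_forall_le (by
      rw [cocompact_eq_atBot_atTop]
      exact (hbot e).sup (htop e))
    exact ⟨s, IsLocalMin.hasDerivAt_eq_zero (Eventually.of_forall hs) (h₁ s e)⟩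
  choose s₀ hs₀ using hcrit
  have hs₀' : ContDiff ℝ ∞ s₀ := contDiff_of_forall_eq_zero hc₁ h₂ hpos hs₀
  let q : ℝ × E → ℝ := fun p =>
    ∫ τ in (0 : ℝ)..1, (1 - τ) * c₂ (s₀ p.2 + τ * (p.1 - s₀ p.2), p.2)
  have hq : ContDiff ℝ ∞ q :=
    contDiff_unitInterval_integral
      (G := fun z : (ℝ × E) × ℝ => (1 - z.2) * c₂ (s₀ z.1.2 + z.2 * (z.1.1 - s₀ z.1.2), z.1.2))
      (by fun_prop)
  have hqpos (p) : 0 < q p := by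
    refine intervalIntegral.intervalIntegral_pos_of_pos_on ?_ (fun τ hτ => ?_) zero_lt_one
    · have := hc₂.continuous
      exact Continuous.intervalIntegrable (by fun_prop) _ _
    · exact mul_pos (by linarith [hτ.2]) (hpos _ _)
  have htaylor (s e) : c (s, e) = (s - s₀ e) ^ 2 * q (s, e) + c (s₀ e, e) := by
    let γ : ℝ → ℝ := fun τ => s₀ e + τ * (s - s₀ e)
    have hγ (τ) : HasDerivAt γ (s - s₀ e) τ :=
      ((((hasDerivAt_id τ).mul_const (s - s₀ e)).const_add (s₀ e)).congr_deriv (one_mul _))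
    -- This function is a primitive of the integral remainder of order two along the segment from
    -- `s₀ e` to `s`.
    have hψ (τ : ℝ) : HasDerivAt
        (fun τ => (1 - τ) * (c₁ (γ τ, e) * (s - s₀ e)) + c (γ τ, e))
        ((s - s₀ e) ^ 2 * ((1 - τ) * c₂ (γ τ, e))) τ := by
      have a := ((hasDerivAt_id τ).const_sub 1).mul
        (((h₂ (γ τ) e).comp τ (hγ τ)).mul_const (s - s₀ e))
      refine (a.add ((h₁ (γ τ) e).comp τ (hγ τ))).congr_deriv ?_
      simp
      ring
    have := intervalIntegral.integral_eq_sub_of_hasDerivAt (a := 0) (b := 1) (fun τ _ => hψ τ) (by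
      have := hc₂.continuous
      exact Continuous.intervalIntegrable (by fun_prop) _ _)
    rw [intervalIntegral.integral_const_mul] at this
    change (s - s₀ e) ^ 2 * q (s, e) = _ at this
    have h0 : γ 0 = s₀ e := by simp [γ]
    have h1 : γ 1 = s := by simp [γ]
    rw [this, h0, h1, hs₀]
    ring
  let ξ : ℝ × E → ℝ := fun p => (p.1 - s₀ p.2) * √(q p)
  have hξ : ContDiff ℝ ∞ ξ :=
    (contDiff_fst.sub (hs₀'.comp contDiff_snd)).mul (hq.sqrt fun p => (hqpos p).ne')
  have hξsq (s e) : c (s, e) = ξ (s, e) ^ 2 + c (s₀ e, e) := by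
    rw [htaylor, mul_pow, Real.sq_sqrt (hqpos _).le]
  have hξd (s e) := hasDerivAt_fst_slice (hξ.differentiable (by simp) (s, e))
  -- Away from `s₀`, `2 ξ ∂ξ = c₁` with `ξ` and `c₁` of the same sign. At `s₀` this degenerates, and
  -- the product rule gives `∂ξ = √q` instead.
  have hξpos (s e) : 0 < fderiv ℝ ξ (s, e) (1, 0) := by
    have hd : 2 * ξ (s, e) * fderiv ℝ ξ (s, e) (1, 0) = c₁ (s, e) := by
      have a := ((hξd s e).pow 2).add_const (c (s₀ e, e))
      have b := h₁ s e
      rw [show (fun s => c (s, e)) = fun s => ξ (s, e) ^ 2 + c (s₀ e, e) from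
        funext fun s => hξsq s e] at b
      simpa using a.unique b
    have hsq := Real.sqrt_pos.2 (hqpos (s, e))
    rcases lt_trichotomy s (s₀ e) with hs | hs | hs
    · have h1 : c₁ (s, e) < 0 := (hmono e hs).trans_eq (hs₀ e)
      have h2 : ξ (s, e) < 0 := mul_neg_of_neg_of_pos (by simpa using hs) hsq
      by_contra! h3
      nlinarith
    · have a : HasDerivAt (fun s => (s - s₀ e) * √(q (s, e)))
          (1 * √(q (s, e)) + (s - s₀ e) * fderiv ℝ (fun p => √(q p)) (s, e) (1, 0)) s :=
        ((hasDerivAt_id s).sub_const (s₀ e)).mul (hasDerivAt_fst_slice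
          ((hq.sqrt fun p => (hqpos p).ne').differentiable (by simp) (s, e)))
      rw [(hξd s e).unique a]
      simpa [hs] using hqpos _
    · have h1 : 0 < c₁ (s, e) := (hs₀ e).symm.trans_lt (hmono e hs)
      have h2 : 0 < ξ (s, e) := mul_pos (by simpa using hs) hsq
      by_contra! h3
      nlinarith
  have hξmono (e : E) : StrictMono fun s => ξ (s, e) :=
    strictMono_of_deriv_pos fun s => by rw [(hξd s e).deriv]; exact hξpos s e
  have hξcont (e : E) : Continuous fun s => ξ (s, e) := hξ.continuous.comp (by fun_prop)
  have hξ0 (e : E) : ξ (s₀ e, e) = 0 := by simp [ξ]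
  have hξsurj (x : ℝ) (e : E) : ∃ s, ξ (s, e) = x := by
    have key : ∀ y, ∃ s, y ≤ ξ (s, e) := fun y => by
      obtain ⟨s, hs, hs'⟩ := (((htop e).eventually_ge_atTop (y ^ 2 + c (s₀ e, e))).and
        (eventually_ge_atTop (s₀ e))).exists
      refine ⟨s, abs_le_of_sq_le_sq' ?_ ?_ |>.2⟩
      · linarith [hξsq s e]
      · simpa [hξ0] using (hξmono e).monotone hs'
    have key' : ∀ y, ∃ s, ξ (s, e) ≤ y := fun y => by
      obtain ⟨s, hs, hs'⟩ := (((hbot e).eventually_ge_atTop (y ^ 2 + c (s₀ e, e))).and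
        (eventually_le_atBot (s₀ e))).exists
      refine ⟨s, ?_⟩
      have h1 : ξ (s, e) ≤ 0 := by simpa [hξ0] using (hξmono e).monotone hs'
      by_contra! h2
      nlinarith [hξsq s e]
    obtain ⟨a, ha⟩ := key' x
    obtain ⟨b, hb⟩ := key x
    exact mem_range_of_exists_le_of_exists_ge (hξcont e) ⟨a, ha⟩ ⟨b, hb⟩
  choose σ hσ using fun p : ℝ × E => hξsurj p.1 p.2
  refine ⟨fun e => c (s₀ e, e), ξ, σ, by fun_prop, hξ, ?_, fun s e => ?_, fun x e => hσ (x, e),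
    hξsq⟩
  -- `σ (x, e)` is the zero of `ξ(·, e) - x`, with the pair `(x, e)` as parameter.
  · refine contDiff_of_forall_eq_zero (g := fun p : ℝ × (ℝ × E) => ξ (p.1, p.2.2) - p.2.1)
      (g₁ := fun p => fderiv ℝ ξ (p.1, p.2.2) (1, 0)) (by fun_prop)
      (fun s p => (hξd s p.2).sub_const p.1) (fun s p => hξpos s p.2) fun p => ?_
    simp [hσ p]
  · exact (hξmono e).injective (hσ _)

end Fold

/-! ### Primitives on the circle -/

theorem isOpenQuotientMap_coe : IsOpenQuotientMap ((↑) : ℝ → UnitAddCircle) :=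
  QuotientAddGroup.isOpenQuotientMap_mk

theorem intervalIntegrable_coe {g : UnitAddCircle → ℝ} (hg : Integrable g) (a b : ℝ) :
    IntervalIntegrable (fun s : ℝ => g (s : UnitAddCircle)) volume a b := by
  have h : Function.Periodic (fun s : ℝ => g (s : UnitAddCircle)) 1 := fun s => by simp
  refine h.intervalIntegrable₀ one_ne_zero ?_ a b
  rw [intervalIntegrable_iff_integrableOn_Ioc_of_le zero_le_one]
  simpa [IntegrableOn, Function.comp_def] using
    (UnitAddCircle.measurePreserving_mk 0).integrable_comp_of_integrable hg

theorem intervalIntegral_zero_one (g : UnitAddCircle → ℝ) :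
    ∫ s in (0 : ℝ)..1, g s = ∫ t, g t := by
  simpa using UnitAddCircle.intervalIntegral_preimage 0 g

/-- The periodic function `t ↦ ∫₀ᵗ g - t ∫ g`. -/
def primitiveFun (g : UnitAddCircle → ℝ) (hg : Integrable g) : C0 where
  toFun := Function.Periodic.lift (f := fun t : ℝ => (∫ s in (0 : ℝ)..t, g s) - t * ∫ s, g s)
    (c := (1 : ℝ)) (fun t => by
      have h : Function.Periodic (fun s : ℝ => g (s : UnitAddCircle)) 1 := fun s => by simp
      have h1 := h.intervalIntegral_add_eq_add 0 t fun a b => intervalIntegrable_coe hg a b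
      rw [zero_add, intervalIntegral_zero_one] at h1
      simp only [h1]
      ring)
  continuous_toFun := isOpenQuotientMap_coe.isQuotientMap.continuous_iff.2
    ((intervalIntegral.continuous_primitive (intervalIntegrable_coe hg) 0).sub (by fun_prop))

theorem primitiveFun_coe {g : UnitAddCircle → ℝ} (hg : Integrable g) (t : ℝ) :
    primitiveFun g hg t = (∫ s in (0 : ℝ)..t, g s) - t * ∫ s, g s :=
  rfl

theorem exists_coe_eq (x : UnitAddCircle) : ∃ t ∈ Set.Icc (0 : ℝ) 1, (t : UnitAddCircle) = x := by
  have : x ∈ ((↑) : ℝ → UnitAddCircle) '' Set.Icc (0 : ℝ) (0 + 1) := by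
    rw [AddCircle.coe_image_Icc_eq]; trivial
  simpa using this

theorem primitiveFun_congr {g h : UnitAddCircle → ℝ} (hg : Integrable g) (hh : Integrable h)
    (e : g =ᵐ[volume] h) : primitiveFun g hg = primitiveFun h hh := by
  ext x
  obtain ⟨t, ht, rfl⟩ := exists_coe_eq x
  rw [primitiveFun_coe, primitiveFun_coe, integral_congr_ae e, H0.integral_congr e ht]

theorem norm_primitiveFun_le {g : UnitAddCircle → ℝ} (hg : Integrable g) :
    ‖primitiveFun g hg‖ ≤ 2 * ∫ t, ‖g t‖ := by
  have h0 : 0 ≤ ∫ t, ‖g t‖ := integral_nonneg fun _ => norm_nonneg _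
  refine (ContinuousMap.norm_le _ (by positivity)).2 fun x => ?_
  obtain ⟨t, ht, rfl⟩ := exists_coe_eq x
  rw [primitiveFun_coe]
  have h1 : ‖∫ s in (0 : ℝ)..t, g s‖ ≤ ∫ t, ‖g t‖ := by
    refine (intervalIntegral.norm_integral_le_integral_norm ht.1).trans ?_
    rw [← intervalIntegral_zero_one fun t => ‖g t‖]
    exact intervalIntegral.integral_mono_interval le_rfl ht.1 ht.2
      (Eventually.of_forall fun _ => norm_nonneg _) (intervalIntegrable_coe hg.norm 0 1)
  have h2 : ‖t * ∫ s, g s‖ ≤ 1 * ∫ t, ‖g t‖ := by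
    rw [norm_mul]
    refine mul_le_mul ?_ (norm_integral_le_integral_norm _) (norm_nonneg _) zero_le_one
    rw [Real.norm_of_nonneg ht.1]
    exact ht.2
  linarith [norm_sub_le (∫ s in (0 : ℝ)..t, g s) (t * ∫ s, g s)]

/-- The operator `g ↦ (t ↦ ∫₀ᵗ g - t ∫ g)` from `L¹` to `C⁰`. -/
def primitive : Lp ℝ 1 (volume : Measure UnitAddCircle) →L[ℝ] C0 :=
  LinearMap.mkContinuous
    { toFun g := primitiveFun g (L1.integrable_coeFn g)
      map_add' g h := by
        have hg := L1.integrable_coeFn g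
        have hh := L1.integrable_coeFn h
        rw [primitiveFun_congr _ (hg.add hh) (Lp.coeFn_add g h)]
        ext x
        obtain ⟨t, ht, rfl⟩ := exists_coe_eq x
        simp only [ContinuousMap.add_apply, primitiveFun_coe, Pi.add_apply]
        rw [integral_add hg hh, intervalIntegral.integral_add (intervalIntegrable_coe hg _ _)
          (intervalIntegrable_coe hh _ _)]
        ring
      map_smul' c g := by
        have hg := L1.integrable_coeFn g
        rw [primitiveFun_congr _ (hg.smul c) (Lp.coeFn_smul c g)]
        ext x
        obtain ⟨t, ht, rfl⟩ := exists_coe_eq x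
        simp only [ContinuousMap.smul_apply, primitiveFun_coe, Pi.smul_apply, smul_eq_mul,
          integral_const_mul, intervalIntegral.integral_const_mul, RingHom.id_apply]
        ring } 2 fun g => by
    rw [L1.norm_eq_integral_norm]
    exact norm_primitiveFun_le (L1.integrable_coeFn g)

theorem primitive_apply (g : Lp ℝ 1 (volume : Measure UnitAddCircle)) :
    primitive g = primitiveFun g (L1.integrable_coeFn g) :=
  rfl

theorem integrable_coe (g : C0) : Integrable g :=
  g.continuous.integrable_of_hasCompactSupport (HasCompactSupport.of_compactSpace _)

/-- The operator `g ↦ (t ↦ ∫₀ᵗ g - t ∫ g)` on `C⁰`. -/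
def meanPrimitive : C0 →L[ℝ] C0 :=
  primitive ∘L ContinuousMap.toLp 1 volume ℝ

/-- The mean value on `C⁰`. -/
def mean : C0 →L[ℝ] ℝ :=
  L1.integralCLM ∘L ContinuousMap.toLp 1 volume ℝ

theorem mean_apply (g : C0) : mean g = ∫ t, g t := by
  rw [mean, ContinuousLinearMap.comp_apply, ← L1.integral_eq, L1.integral_eq_integral]
  exact integral_congr_ae (ContinuousMap.coeFn_toLp volume g)

theorem meanPrimitive_coe (g : C0) (t : ℝ) :
    meanPrimitive g t = (∫ s in (0 : ℝ)..t, g s) - t * mean g := by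
  have h := ContinuousMap.coeFn_toLp (p := 1) (𝕜 := ℝ) volume g
  rw [mean_apply, meanPrimitive, ContinuousLinearMap.comp_apply, primitive_apply,
    primitiveFun_congr _ (integrable_coe g) h, primitiveFun_coe]

theorem meanPrimitive_zero (g : C0) : meanPrimitive g ((0 : ℝ) : UnitAddCircle) = 0 := by
  simp [meanPrimitive_coe, -QuotientAddGroup.mk_zero]

theorem continuous_coe_comp (g : C0) : Continuous fun s : ℝ => g (s : UnitAddCircle) :=
  g.continuous.comp (AddCircle.continuous_mk' 1)

theorem hasDerivAt_meanPrimitive (g : C0) (t : ℝ) :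
    HasDerivAt (fun s : ℝ => meanPrimitive g s) (g t - mean g) t := by
  have h := continuous_coe_comp g
  simp only [meanPrimitive_coe]
  have h1 := (h.integral_hasStrictDerivAt 0 t).hasDerivAt.sub
    ((hasDerivAt_id t).mul_const (mean g))
  simpa using! h1

theorem norm_mean_le (g : C0) : ‖mean g‖ ≤ ‖g‖ := by
  rw [mean_apply]
  simpa [Measure.real] using norm_integral_le_of_norm_le_const (μ := (volume : Measure UnitAddCircle))
    (Eventually.of_forall fun x => g.norm_coe_le_norm x)

theorem mean_const (c : ℝ) : mean (ContinuousMap.const _ c) = c := by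
  simp [mean_apply, Measure.real]

/-- Arzelà–Ascoli: on the unit ball the derivative `g - mean g` of the primitive is bounded by `2`,
so the image is bounded and equi-Lipschitz. -/
theorem isCompactOperator_meanPrimitive : IsCompactOperator meanPrimitive := by
  let e := ContinuousMap.isometryEquivBoundedOfCompact UnitAddCircle ℝ
  let A : Set (BoundedContinuousFunction UnitAddCircle ℝ) :=
    (fun g => e (meanPrimitive g)) '' Metric.ball 0 1
  have hA : IsCompact (closure A) := by
    refine BoundedContinuousFunction.arzela_ascoli (Metric.closedBall 0 ‖meanPrimitive‖)
      (isCompact_closedBall _ _) A ?_ ?_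
    · rintro _ x ⟨g, hg, rfl⟩
      have h1 : ‖meanPrimitive g‖ ≤ ‖meanPrimitive‖ * 1 :=
        meanPrimitive.le_opNorm_of_le (mem_ball_zero_iff.1 hg).le
      rw [mem_closedBall_zero_iff]
      exact ((meanPrimitive g).norm_coe_le_norm x).trans (by linarith)
    · intro x
      obtain ⟨t, -, rfl⟩ := exists_coe_eq x
      intro U hU
      obtain ⟨ε, hε, hεU⟩ := Metric.mem_uniformity_dist.1 hU
      rw [QuotientAddGroup.nhds_eq, eventually_map]
      filter_upwards [Metric.ball_mem_nhds t (half_pos hε)] with s hs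
      rintro ⟨_, g, hg, rfl⟩
      refine hεU ?_
      have h1 (r : ℝ) : ‖g r - mean g‖ ≤ 2 := by
        have := mem_ball_zero_iff.1 hg
        linarith [norm_sub_le (g r) (mean g), norm_mean_le g, g.norm_coe_le_norm r]
      have h2 := convex_univ.norm_image_sub_le_of_norm_hasDerivWithin_le (x := s) (y := t)
        (fun r _ => (hasDerivAt_meanPrimitive g r).hasDerivWithinAt) (fun r _ => h1 r)
        trivial trivial
      rw [dist_comm, dist_eq_norm]
      rw [Metric.mem_ball, dist_comm, dist_eq_norm] at hs
      change ‖meanPrimitive g s - meanPrimitive g t‖ < ε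
      rw [norm_sub_rev]
      linarith
  refine ⟨e.symm '' closure A, hA.image e.symm.continuous, ?_⟩
  filter_upwards [Metric.ball_mem_nhds (0 : C0) one_pos] with g hg
  exact ⟨e (meanPrimitive g), subset_closure ⟨g, hg, rfl⟩, e.symm_apply_apply _⟩

/-! ### Scalar differential equations on a period -/

/-- If every zero were crossed upwards, `w` would stay nonnegative on `[0, 1]` after starting at
`0`, yet be negative just before its zero at `1`. -/
theorem exists_eq_zero_deriv_nonpos {w w' : ℝ → ℝ} (hw : ∀ t, HasDerivAt w (w' t) t)
    (h0 : w 0 = 0) (h1 : w 1 = 0) : ∃ t, w t = 0 ∧ w' t ≤ 0 := by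
  by_contra! h
  have hnonneg : ∀ t ∈ Set.Icc (0 : ℝ) 1, -w t ≤ 0 := fun t ht =>
    image_le_of_deriv_right_lt_deriv_boundary (f := fun t => -w t) (f' := fun t => -w' t)
      (B := fun _ => 0) (B' := fun _ => 0) (a := 0) (b := 1)
      (fun s _ => (hw s).neg.continuousAt.continuousWithinAt)
      (fun s _ => (hw s).neg.hasDerivWithinAt) (by simp [h0]) (fun s => hasDerivAt_const s 0)
      (fun s _ hs => by linarith [h s (by linarith)]) ht
  have hpos : ∀ᶠ s in 𝓝[<] (1 : ℝ), 0 < slope w 1 s :=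
    ((hasDerivAt_iff_tendsto_slope.1 (hw 1)).mono_left
      (nhdsWithin_mono _ fun s hs => ne_of_lt hs)).eventually_const_lt (h 1 h1)
  have hI : ∀ᶠ s in 𝓝[<] (1 : ℝ), s ∈ Set.Ioo (0 : ℝ) 1 := Ioo_mem_nhdsLT zero_lt_one
  obtain ⟨s, hs, hs'⟩ := (hpos.and hI).exists
  rw [slope_def_field, h1, sub_zero] at hs
  exact hs.not_ge (div_nonpos_of_nonneg_of_nonpos
    (by linarith [hnonneg s ⟨hs'.1.le, hs'.2.le⟩]) (by linarith [hs'.2]))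

theorem exists_eq_zero_deriv_nonneg {w w' : ℝ → ℝ} (hw : ∀ t, HasDerivAt w (w' t) t)
    (h0 : w 0 = 0) (h1 : w 1 = 0) : ∃ t, w t = 0 ∧ 0 ≤ w' t := by
  obtain ⟨t, ht, ht'⟩ := exists_eq_zero_deriv_nonpos (fun t => (hw t).neg)
    (by simp [h0]) (by simp [h1])
  exact ⟨t, by simpa using ht, by simpa using ht'⟩

theorem eq_zero_of_abs_deriv_le {w w' : ℝ → ℝ} {K : ℝ} (hw : ∀ t, HasDerivAt w (w' t) t)
    (h0 : w 0 = 0) (hK : ∀ t, |w' t| ≤ K * |w t|) {t : ℝ} (ht : t ∈ Set.Icc (0 : ℝ) 1) :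
    w t = 0 :=
  eq_zero_of_abs_deriv_le_mul_abs_self_of_eq_zero_right
    (fun s _ => (hw s).continuousAt.continuousWithinAt) (fun s _ => (hw s).hasDerivWithinAt) h0
    (fun s _ => hK s) t ht

/-- With the integrating factor `μ = exp ∫ a`, `(μ k)' = μ g`. The integral of `μ g` over the period
vanishes, but `μ g ≤ 0` with strict inequality at `0`. -/
theorem false_of_linear_of_nonpos {k a g : ℝ → ℝ} (ha : Continuous a) (hg : Continuous g)
    (hk : ∀ t, HasDerivAt k (g t - a t * k t) t) (h0 : k 0 = 0) (h1 : k 1 = 0)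
    (hle : ∀ t, g t ≤ 0) (hlt : g 0 < 0) : False := by
  let μ : ℝ → ℝ := fun t => Real.exp (∫ s in (0 : ℝ)..t, a s)
  have hμ (t : ℝ) : HasDerivAt μ (μ t * a t) t :=
    (ha.integral_hasStrictDerivAt 0 t).hasDerivAt.exp
  have hμc : Continuous μ := continuous_iff_continuousAt.2 fun t => (hμ t).continuousAt
  have hprod (t : ℝ) : HasDerivAt (fun t => μ t * k t) (μ t * g t) t :=
    ((hμ t).mul (hk t)).congr_deriv (by ring)
  have hint := intervalIntegral.integral_eq_sub_of_hasDerivAt (a := 0) (b := 1)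
    (fun t _ => hprod t) ((hμc.mul hg).intervalIntegrable _ _)
  simp only [h0, h1, mul_zero, sub_zero] at hint
  have hpos : 0 < ∫ t in (0 : ℝ)..1, -(μ t * g t) :=
    intervalIntegral.integral_pos zero_lt_one (hμc.mul hg).neg.continuousOn
      (fun t _ => by have := hle t; have := Real.exp_pos (∫ s in (0 : ℝ)..t, a s); nlinarith)
      ⟨0, by simp, by have := Real.exp_pos (∫ s in (0 : ℝ)..0, a s); nlinarith⟩
  rw [intervalIntegral.integral_neg, hint] at hpos
  simp at hpos

/-! ### Superposition operators -/

/-- Pointwise multiplication on `C⁰`. -/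
def mulC : C0 →L[ℝ] C0 →L[ℝ] C0 :=
  ContinuousLinearMap.mul ℝ C0

@[simp]
theorem mulC_apply (g h : C0) : mulC g h = g * h :=
  rfl

theorem contDiff_mulC {n : WithTop ℕ∞} : ContDiff ℝ n (fun g : C0 => mulC g) := by
  fun_prop

/-- The operator `u ↦ f(·, u(·))` on `C⁰`. -/
def superposition (f : C(UnitAddCircle × ℝ, ℝ)) (u : C0) : C0 :=
  f.comp ((ContinuousMap.id UnitAddCircle).prodMk u)

@[simp]
theorem superposition_apply (f : C(UnitAddCircle × ℝ, ℝ)) (u : C0) (t : UnitAddCircle) :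
    superposition f u t = f (t, u t) :=
  rfl

theorem continuous_superposition (f : C(UnitAddCircle × ℝ, ℝ)) :
    Continuous (superposition f) := by
  unfold superposition
  refine (ContinuousMap.continuous_postcomp f).comp ?_
  refine ContinuousMap.continuous_of_continuous_uncurry _ ?_
  exact continuous_snd.prodMk (continuous_eval.comp (continuous_fst.prodMk continuous_snd))

theorem SmoothOnCylinder.exists_partial {f : UnitAddCircle × ℝ → ℝ} (hf : SmoothOnCylinder f) :
    ∃ f' : C(UnitAddCircle × ℝ, ℝ), SmoothOnCylinder f' ∧
      ∀ t x, HasDerivAt (fun y => f (t, y)) (f' (t, x)) x := by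
  have hd (t x : ℝ) : HasDerivAt (fun y => f (t, y))
      (fderiv ℝ (fun p : ℝ × ℝ => f ((p.1 : UnitAddCircle), p.2)) (t, x) (0, 1)) x :=
    (hf.differentiable (by simp) (t, x)).hasFDerivAt.comp_hasDerivAt x
      ((hasDerivAt_const x t).prodMk (hasDerivAt_id x))
  let f' : UnitAddCircle × ℝ → ℝ := fun p => deriv (fun y => f (p.1, y)) p.2
  have hf' : SmoothOnCylinder f' := by
    have : (fun p : ℝ × ℝ => f' ((p.1 : UnitAddCircle), p.2)) = fun p =>
        fderiv ℝ (fun p : ℝ × ℝ => f ((p.1 : UnitAddCircle), p.2)) p (0, 1) :=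
      funext fun p => (hd p.1 p.2).deriv
    unfold SmoothOnCylinder
    rw [this]
    exact (hf.fderiv_right (m := ∞) (by simp)).clm_apply contDiff_const
  refine ⟨⟨f', ?_⟩, hf', fun t x => ?_⟩
  · exact (isOpenQuotientMap_coe.prodMap .id).isQuotientMap.continuous_iff.2 hf'.continuous
  · obtain ⟨t, -, rfl⟩ := exists_coe_eq t
    exact (hd t x).differentiableAt.hasDerivAt

/-- Mean value inequality along `τ ↦ u + τ h` after removing the linear term. Continuity of
`superposition f'` in the sup norm makes the estimate uniform in `t`. -/
theorem hasFDerivAt_superposition {f f' : C(UnitAddCircle × ℝ, ℝ)}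
    (hf : ∀ t x, HasDerivAt (fun y => f (t, y)) (f' (t, x)) x) (u : C0) :
    HasFDerivAt (superposition f) (mulC (superposition f' u)) u := by
  rw [hasFDerivAt_iff_isLittleO_nhds_zero, Asymptotics.isLittleO_iff]
  intro ε hε
  obtain ⟨δ, hδ, hδε⟩ := Metric.continuous_iff.1 (continuous_superposition f') u ε hε
  filter_upwards [Metric.ball_mem_nhds (0 : C0) hδ] with h hh
  rw [mem_ball_zero_iff] at hh
  refine (ContinuousMap.norm_le _ (by positivity)).2 fun t => ?_
  have hd (τ : ℝ) : HasDerivAt (fun τ : ℝ => f (t, u t + τ * h t) - τ * (f' (t, u t) * h t))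
      ((f' (t, u t + τ * h t) - f' (t, u t)) * h t) τ := by
    have h1 : HasDerivAt (fun τ : ℝ => u t + τ * h t) (h t) τ :=
      (((hasDerivAt_id τ).mul_const (h t)).const_add (u t)).congr_deriv (one_mul _)
    exact (((hf t _).comp τ h1).sub ((hasDerivAt_id τ).mul_const _)).congr_deriv (by simp; ring)
  have hb : ∀ τ ∈ Set.Ico (0 : ℝ) 1,
      ‖(f' (t, u t + τ * h t) - f' (t, u t)) * h t‖ ≤ ε * ‖h‖ := by
    intro τ hτ
    rw [norm_mul]
    refine mul_le_mul ?_ (h.norm_coe_le_norm t) (norm_nonneg _) hε.le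
    have h1 : dist (u + τ • h) u < δ := by
      rw [dist_eq_norm, add_sub_cancel_left, norm_smul, Real.norm_of_nonneg hτ.1]
      nlinarith [norm_nonneg h, hτ.2]
    have h2 := (superposition f' (u + τ • h) - superposition f' u).norm_coe_le_norm t
    have h3 := hδε _ h1
    rw [dist_eq_norm] at h3
    simpa using h2.trans h3.le
  have := norm_image_sub_le_of_norm_deriv_le_segment_01'
    (fun τ _ => (hd τ).hasDerivWithinAt) hb
  refine le_trans (le_of_eq ?_) this
  simp
  ring_nf

theorem contDiff_superposition {f : C(UnitAddCircle × ℝ, ℝ)} (hf : SmoothOnCylinder f) :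
    ContDiff ℝ ∞ (superposition f) := by
  refine contDiff_infty.2 fun n => ?_
  induction n generalizing f with
  | zero => exact contDiff_zero.2 (continuous_superposition f)
  | succ n ih =>
    obtain ⟨f', hf', hd⟩ := hf.exists_partial
    exact contDiff_succ_iff_hasFDerivAt.2
      ⟨fun u => mulC (superposition f' u),
      contDiff_mulC.comp (ih hf'), hasFDerivAt_superposition hd⟩

/-- A proper function which tends to infinity on each line does so uniformly. -/
theorem exists_forall_le_of_isProperMap {f : C(UnitAddCircle × ℝ, ℝ)} (hproper : IsProperMap f)
    (htop : ∀ t : UnitAddCircle, Tendsto (fun x : ℝ => f (t, x)) atTop atTop)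
    (hbot : ∀ t : UnitAddCircle, Tendsto (fun x : ℝ => f (t, x)) atBot atTop) (M : ℝ) :
    ∃ R, 0 < R ∧ ∀ t x, R ≤ |x| → M < f (t, x) := by
  -- Beyond a compact level set the value `M` is never taken; a point there with `f ≤ M` would, by
  -- the intermediate value theorem on the outward ray, produce one.
  have hK : IsCompact (f ⁻¹' {M}) := hproper.isCompact_preimage isCompact_singleton
  obtain ⟨R, hR⟩ := (hK.image continuous_snd).isBounded.exists_norm_le
  have hne (t x) (hx : R < |x|) : f (t, x) ≠ M := fun h =>
    hx.not_ge (hR x ⟨(t, x), h, rfl⟩)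
  have hc (t : UnitAddCircle) : Continuous fun x => f (t, x) := f.continuous.comp (by fun_prop)
  refine ⟨max R 0 + 1, by positivity, fun t x hx => ?_⟩
  have hx' : R < |x| := by linarith [le_max_left R 0]
  have hx0 : 0 < |x| := by linarith [le_max_right R 0]
  by_contra! hle
  rcases lt_or_gt_of_ne (abs_pos.1 hx0) with hneg | hpos
  · obtain ⟨y, hy, hyx⟩ := (((hbot t).eventually_ge_atTop M).and (eventually_le_atBot x)).exists
    obtain ⟨z, hz, hzM⟩ := intermediate_value_Icc' hyx (hc t).continuousOn ⟨hle, hy⟩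
    refine hne t z (hx'.trans_le ?_) hzM
    rw [abs_of_neg hneg, abs_of_neg (hz.2.trans_lt hneg)]
    linarith [hz.2]
  · obtain ⟨y, hy, hyx⟩ := (((htop t).eventually_ge_atTop M).and (eventually_ge_atTop x)).exists
    obtain ⟨z, hz, hzM⟩ := intermediate_value_Icc hyx (hc t).continuousOn ⟨hle, hy⟩
    refine hne t z (hx'.trans_le ?_) hzM
    rw [abs_of_pos hpos, abs_of_pos (hpos.trans_le hz.1)]
    exact hz.1

/-! ### Straightening the equation -/

theorem meanPrimitive_one (g : C0) : meanPrimitive g ((1 : ℝ) : UnitAddCircle) = 0 := by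
  rw [AddCircle.coe_period, ← QuotientAddGroup.mk_zero]
  exact meanPrimitive_zero g

/-- Here `w' = mean g - g` and `g` vanishes wherever `w` does, so `w' = mean g` at every zero of
`w`. Since `w` vanishes at `0` and `1`, these crossings cannot all have one strict sign, so `mean g
= 0`; then `|w'| ≤ K |w|` and Grönwall conclude. It serves both for injectivity of `straighten f`
and for the kernel of its linearization. -/
theorem eq_zero_of_eq_neg_meanPrimitive {w g : C0} {K : ℝ} (hw : w = -meanPrimitive g)
    (hK : ∀ t, |g t| ≤ K * |w t|) : w = 0 := by
  have hd (t : ℝ) : HasDerivAt (fun s : ℝ => w s) (mean g - g t) t := by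
    rw [hw]
    exact (hasDerivAt_meanPrimitive g t).neg.congr_deriv (neg_sub _ _)
  have h0 : w ((0 : ℝ) : UnitAddCircle) = 0 := by
    rw [hw, ContinuousMap.neg_apply, meanPrimitive_zero, neg_zero]
  have h1 : w ((1 : ℝ) : UnitAddCircle) = 0 := by
    rw [hw, ContinuousMap.neg_apply, meanPrimitive_one, neg_zero]
  have hg (t) (ht : w t = 0) : g t = 0 := by simpa [ht] using hK t
  have hmean : mean g = 0 := by
    obtain ⟨t, ht, ht'⟩ := exists_eq_zero_deriv_nonpos hd h0 h1
    obtain ⟨s, hs, hs'⟩ := exists_eq_zero_deriv_nonneg hd h0 h1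
    rw [hg _ ht] at ht'
    rw [hg _ hs] at hs'
    linarith
  ext x
  obtain ⟨t, ht, rfl⟩ := exists_coe_eq x
  exact eq_zero_of_abs_deriv_le (K := K) hd h0 (fun t => by simpa [hmean] using hK t) ht

/-- The map `u ↦ u + Q f(·, u)` on `C⁰`, where `Q g` is the primitive of `g - ∫ g` vanishing
at `0`. -/
def straighten (f : C(UnitAddCircle × ℝ, ℝ)) (u : C0) : C0 :=
  u + meanPrimitive (superposition f u)

theorem contDiff_straighten {f : C(UnitAddCircle × ℝ, ℝ)} (hf : SmoothOnCylinder f) :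
    ContDiff ℝ ∞ (straighten f) :=
  contDiff_id.add (meanPrimitive.contDiff.comp (contDiff_superposition hf))

theorem exists_norm_le_of_abs_le (f : C(UnitAddCircle × ℝ, ℝ)) (R : ℝ) :
    ∃ K, 0 ≤ K ∧ ∀ t x, |x| ≤ R → |f (t, x)| ≤ K := by
  obtain ⟨K, hK⟩ := ((isCompact_univ (X := UnitAddCircle)).prod
    (isCompact_Icc (a := -R) (b := R))).exists_bound_of_continuousOn f.continuous.continuousOn
  exact ⟨max K 0, le_max_right _ _, fun t x hx =>
    (hK (t, x) ⟨trivial, abs_le.1 hx⟩).trans (le_max_left _ _)⟩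

theorem straighten_injective {f f' : C(UnitAddCircle × ℝ, ℝ)}
    (hd : ∀ t x, HasDerivAt (fun y => f (t, y)) (f' (t, x)) x) :
    Function.Injective (straighten f) := by
  intro u v huv
  obtain ⟨K, -, hK⟩ := exists_norm_le_of_abs_le f' (max ‖u‖ ‖v‖)
  refine sub_eq_zero.1 (eq_zero_of_eq_neg_meanPrimitive (K := K)
    (g := superposition f u - superposition f v) ?_ fun t => ?_)
  · rw [map_sub]
    simp only [straighten] at huv
    rw [← sub_eq_zero] at huv ⊢
    rw [← huv]
    abel
  · exact (convex_Icc (-max ‖u‖ ‖v‖) (max ‖u‖ ‖v‖)).norm_image_sub_le_of_norm_hasDerivWithin_le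
      (fun x _ => (hd t x).hasDerivWithinAt) (fun x hx => hK t x (abs_le.2 hx))
      (abs_le.1 ((v.norm_coe_le_norm t).trans (le_max_right _ _)))
      (abs_le.1 ((u.norm_coe_le_norm t).trans (le_max_left _ _)))

/-- Fredholm alternative for a compact operator: `-1` is not an eigenvalue, hence lies in the
resolvent set. -/
theorem exists_equiv_id_add_meanPrimitive (a : C0) :
    ∃ T : C0 ≃L[ℝ] C0, (T : C0 →L[ℝ] C0) = .id ℝ C0 + meanPrimitive ∘L mulC a := by
  have hcomp : IsCompactOperator (meanPrimitive ∘L mulC a) :=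
    isCompactOperator_meanPrimitive.comp_clm (mulC a)
  rcases hcomp.hasEigenvalue_or_mem_resolventSet (μ := (-1 : ℝ)) (by norm_num) with h | h
  · obtain ⟨w, hw⟩ := h.exists_hasEigenvector
    refine absurd (eq_zero_of_eq_neg_meanPrimitive (g := a * w) (K := ‖a‖) ?_ fun t => ?_) hw.2
    · have h1 : meanPrimitive (a * w) = (-1 : ℝ) • w := hw.apply_eq_smul
      rw [h1]
      simp
    · rw [ContinuousMap.mul_apply, abs_mul]
      exact mul_le_mul_of_nonneg_right (a.norm_coe_le_norm t) (abs_nonneg _)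
  · rw [spectrum.mem_resolventSet_iff, ← IsUnit.neg_iff] at h
    obtain ⟨U, hU⟩ := h
    refine ⟨ContinuousLinearEquiv.unitsEquiv ℝ C0 U, ?_⟩
    ext w t
    have h1 := congrArg (fun S : C0 →L[ℝ] C0 => S w t) hU
    simpa [add_comm] using h1

theorem exists_hasFDerivAt_straighten {f f' : C(UnitAddCircle × ℝ, ℝ)}
    (hd : ∀ t x, HasDerivAt (fun y => f (t, y)) (f' (t, x)) x) (u : C0) :
    ∃ T : C0 ≃L[ℝ] C0, HasFDerivAt (straighten f) (T : C0 →L[ℝ] C0) u := by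
  obtain ⟨T, hT⟩ := exists_equiv_id_add_meanPrimitive (superposition f' u)
  refine ⟨T, ?_⟩
  rw [hT]
  exact (hasFDerivAt_id u).add
    (meanPrimitive.hasFDerivAt.comp u (hasFDerivAt_superposition hd u))

/-- Uniform growth at infinity in the second variable. -/
def UniformlyCoercive (f : C(UnitAddCircle × ℝ, ℝ)) : Prop :=
  ∀ M : ℝ, ∃ R, 0 < R ∧ ∀ t x, R ≤ |x| → M < f (t, x)

theorem hasDerivAt_sub_straighten (f : C(UnitAddCircle × ℝ, ℝ)) (u : C0) (t : ℝ) :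
    HasDerivAt (fun s : ℝ => u s - straighten f u s)
      (mean (superposition f u) - f (t, u t)) t := by
  have := (hasDerivAt_meanPrimitive (superposition f u) t).neg
  simpa [straighten] using! this

/-- `u - straighten f u` vanishes at `0` and `1`. At a zero where its derivative `mean - f(t, u)` is
nonpositive, `u` may be replaced by the known function `straighten f u`. -/
theorem exists_mean_le (f : C(UnitAddCircle × ℝ, ℝ)) (u : C0) :
    ∃ t, mean (superposition f u) ≤ f (t, straighten f u t) := by
  obtain ⟨t, ht, ht'⟩ := exists_eq_zero_deriv_nonpos (hasDerivAt_sub_straighten f u)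
    (by simp only [straighten, ContinuousMap.add_apply, meanPrimitive_zero]; ring)
    (by simp only [straighten, ContinuousMap.add_apply, meanPrimitive_one]; ring)
  refine ⟨t, ?_⟩
  rw [← sub_eq_zero.1 ht]
  linarith

theorem exists_le_mean (f : C(UnitAddCircle × ℝ, ℝ)) (u : C0) :
    ∃ t, f (t, straighten f u t) ≤ mean (superposition f u) := by
  obtain ⟨t, ht, ht'⟩ := exists_eq_zero_deriv_nonneg (hasDerivAt_sub_straighten f u)
    (by simp only [straighten, ContinuousMap.add_apply, meanPrimitive_zero]; ring)
    (by simp only [straighten, ContinuousMap.add_apply, meanPrimitive_one]; ring)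
  refine ⟨t, ?_⟩
  rw [← sub_eq_zero.1 ht]
  linarith

/-- At an extremum of `u - straighten f u`, `f(t, u)` equals the mean of `f(·, u)`, which
`exists_mean_le` bounds; coercivity then bounds `u` there. So `|u - straighten f u| ≤ R + M`
everywhere. -/
theorem UniformlyCoercive.exists_norm_le {f : C(UnitAddCircle × ℝ, ℝ)}
    (hf : UniformlyCoercive f) (M : ℝ) : ∃ B, ∀ u, ‖straighten f u‖ ≤ M → ‖u‖ ≤ B := by
  obtain ⟨K, -, hK⟩ := exists_norm_le_of_abs_le f M
  obtain ⟨R, hR, hRf⟩ := hf K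
  refine ⟨R + 2 * M, fun u hu => ?_⟩
  have hM : 0 ≤ M := (norm_nonneg _).trans hu
  have hy (t) : |straighten f u t| ≤ M := ((straighten f u).norm_coe_le_norm t).trans hu
  have hmean : mean (superposition f u) ≤ K := by
    obtain ⟨t, ht⟩ := exists_mean_le f u
    exact ht.trans ((le_abs_self _).trans (hK t _ (hy t)))
  have hext (t : ℝ) (ht : IsLocalExtr (fun s : ℝ => u s - straighten f u s) t) :
      |u t| < R := by
    by_contra! h
    have h1 := ht.hasDerivAt_eq_zero (hasDerivAt_sub_straighten f u t)
    linarith [hRf t _ h]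
  have hcont : Continuous fun x => u x - straighten f u x := by fun_prop
  obtain ⟨x, -, hx⟩ := isCompact_univ.exists_isMaxOn Set.univ_nonempty hcont.continuousOn
  obtain ⟨y, -, hy'⟩ := isCompact_univ.exists_isMinOn Set.univ_nonempty hcont.continuousOn
  obtain ⟨a, -, rfl⟩ := exists_coe_eq x
  obtain ⟨b, -, rfl⟩ := exists_coe_eq y
  have ha := abs_lt.1 (hext a (.inr (Eventually.of_forall fun s => hx (Set.mem_univ (s : _)))))
  have hb := abs_lt.1 (hext b (.inl (Eventually.of_forall fun s => hy' (Set.mem_univ (s : _)))))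
  refine (ContinuousMap.norm_le _ (by positivity)).2 fun t => ?_
  have h1 : u t - straighten f u t ≤ u a - straighten f u a := hx (Set.mem_univ t)
  have h2 : u b - straighten f u b ≤ u t - straighten f u t := hy' (Set.mem_univ t)
  have h3 := abs_le.1 (hy a)
  have h4 := abs_le.1 (hy b)
  have h5 := abs_le.1 (hy t)
  rw [Real.norm_eq_abs, abs_le]
  constructor <;> linarith [h1, h2, h3.1, h3.2, h4.1, h4.2, h5.1, h5.2, ha.1, ha.2, hb.1, hb.2]

theorem straighten_surjective {f : C(UnitAddCircle × ℝ, ℝ)} (hf : SmoothOnCylinder f)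
    (hcoer : UniformlyCoercive f) : Function.Surjective (straighten f) := by
  obtain ⟨f', -, hd⟩ := hf.exists_partial
  have hcd := contDiff_straighten hf
  have hopen : IsOpen (Set.range (straighten f)) := by
    refine IsOpenMap.isOpen_range (isOpenMap_iff_nhds_le.2 fun u => ?_)
    obtain ⟨T, hT⟩ := exists_hasFDerivAt_straighten hd u
    exact ((hcd.contDiffAt.hasStrictFDerivAt' hT (by simp)).map_nhds_eq_of_equiv).ge
  have hclosed : IsClosed (Set.range (straighten f)) := by
    refine IsSeqClosed.isClosed fun y y₀ hy hlim => ?_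
    choose u hu using hy
    obtain ⟨M, hM⟩ := (Metric.isBounded_range_of_tendsto y hlim).exists_norm_le
    obtain ⟨B, hB⟩ := hcoer.exists_norm_le M
    obtain ⟨K, hK0, hK⟩ := exists_norm_le_of_abs_le f B
    obtain ⟨S, hS, hKS⟩ := isCompactOperator_meanPrimitive.image_closedBall_subset_compact K
    -- The a priori bound puts the nonlinear terms in a compact set. Along a subsequence they
    -- converge, hence so does `u n = y n - Q N(u n)`.
    have hmem (n : ℕ) : meanPrimitive (superposition f (u n)) ∈ S := by
      refine hKS ⟨_, mem_closedBall_zero_iff.2 ((ContinuousMap.norm_le _ hK0).2 fun t => ?_), rfl⟩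
      refine hK t _ (((u n).norm_coe_le_norm t).trans (hB _ ?_))
      rw [hu]
      exact hM _ ⟨n, rfl⟩
    obtain ⟨v, -, φ, hφ, hv⟩ := hS.tendsto_subseq hmem
    have hy' := hlim.comp hφ.tendsto_atTop
    have hu' : Tendsto (u ∘ φ) atTop (𝓝 (y₀ - v)) := by
      refine (hy'.sub hv).congr fun n => ?_
      simp [← hu, straighten]
    exact ⟨y₀ - v, tendsto_nhds_unique ((hcd.continuous.tendsto _).comp hu')
      (hy'.congr fun n => (hu _).symm)⟩
  have := IsClopen.eq_univ ⟨hclosed, hopen⟩ (Set.range_nonempty _)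
  exact Set.range_eq_univ.1 this

theorem exists_straighten_inverse {f : C(UnitAddCircle × ℝ, ℝ)} (hf : SmoothOnCylinder f)
    (hcoer : UniformlyCoercive f) :
    ∃ Ψ : C0 → C0, ContDiff ℝ ∞ Ψ ∧ (∀ u, Ψ (straighten f u) = u) ∧
      ∀ y, straighten f (Ψ y) = y := by
  obtain ⟨f', -, hd⟩ := hf.exists_partial
  have hcd := contDiff_straighten hf
  choose T hT using exists_hasFDerivAt_straighten hd
  have hopen : IsOpenMap (straighten f) := isOpenMap_iff_nhds_le.2 fun u =>
    ((hcd.contDiffAt.hasStrictFDerivAt' (hT u) (by simp)).map_nhds_eq_of_equiv).ge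
  let e := (Equiv.ofBijective _ ⟨straighten_injective hd, straighten_surjective hf hcoer⟩)
    |>.toHomeomorphOfContinuousOpen hcd.continuous hopen
  exact ⟨e.symm, e.contDiff_symm hT hcd, e.symm_apply_apply, e.apply_symm_apply⟩

/-! ### The height function -/

/-- For `Ψ` inverse to `straighten f`, the mean of `f(·, u)` at `u = Ψ (s + e)`. -/
def height (f : C(UnitAddCircle × ℝ, ℝ)) (Ψ : C0 → C0) (p : ℝ × C0) : ℝ :=
  mean (superposition f (Ψ (p.1 • 1 + p.2)))

theorem contDiff_height {f : C(UnitAddCircle × ℝ, ℝ)} (hf : SmoothOnCylinder f) {Ψ : C0 → C0}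
    (hΨ : ContDiff ℝ ∞ Ψ) : ContDiff ℝ ∞ (height f Ψ) :=
  mean.contDiff.comp ((contDiff_superposition hf).comp (hΨ.comp
    ((contDiff_fst.smul contDiff_const).add contDiff_snd)))

theorem hasDerivAt_superposition_comp {f f' : C(UnitAddCircle × ℝ, ℝ)}
    (hd : ∀ t x, HasDerivAt (fun y => f (t, y)) (f' (t, x)) x) {U : ℝ → C0} {h : C0} {s : ℝ}
    (hU : HasDerivAt U h s) :
    HasDerivAt (fun s => superposition f (U s)) (superposition f' (U s) * h) s :=
  (hasFDerivAt_superposition hd (U s)).comp_hasDerivAt s hU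

/-- Differentiating `u + Q N(u) = s + e` in `s` gives `h + Q g₁ = 1` and `k + Q g₂ = 0` for `h = ∂u`
and `k = ∂²u`; the derivatives of the height are `mean g₁` and `mean g₂`. -/
theorem exists_height_derivs {f : C(UnitAddCircle × ℝ, ℝ)} (hf : SmoothOnCylinder f)
    (hconvex : ∀ t x, 0 < D₂D₂ f t x) {Ψ : C0 → C0} (hΨ : ContDiff ℝ ∞ Ψ)
    (hinv : ∀ y, straighten f (Ψ y) = y) :
    ∃ c₁ c₂ : ℝ × C0 → ℝ,
      (∀ s e, HasDerivAt (fun s => height f Ψ (s, e)) (c₁ (s, e)) s) ∧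
      (∀ s e, HasDerivAt (fun s => c₁ (s, e)) (c₂ (s, e)) s) ∧ ∀ s e, 0 < c₂ (s, e) := by
  obtain ⟨f₁, hf₁, hd₁⟩ := hf.exists_partial
  obtain ⟨f₂, -, hd₂⟩ := hf₁.exists_partial
  have hf₂ (t x) : 0 < f₂ (t, x) := by
    have := hconvex t x
    rw [D₂D₂, iteratedDeriv_succ, iteratedDeriv_one,
      show deriv (fun y => f (t, y)) = fun y => f₁ (t, y) from funext fun y => (hd₁ t y).deriv,
      (hd₂ t x).deriv] at this
    exact this
  let U (e : C0) (s : ℝ) : C0 := Ψ (s • 1 + e)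
  have hU (e : C0) : ContDiff ℝ ∞ (U e) :=
    hΨ.comp ((contDiff_id.smul contDiff_const).add contDiff_const)
  have hU₁ (e : C0) (s : ℝ) : HasDerivAt (U e) (deriv (U e) s) s :=
    ((hU e).differentiable (by simp) s).hasDerivAt
  have hU₂ (e : C0) (s : ℝ) : HasDerivAt (deriv (U e)) (deriv (deriv (U e)) s) s :=
    (((contDiff_infty_iff_deriv.1 (hU e)).2).differentiable (by simp) s).hasDerivAt
  let g₁ (e : C0) (s : ℝ) : C0 := superposition f₁ (U e s) * deriv (U e) s
  let g₂ (e : C0) (s : ℝ) : C0 := superposition f₂ (U e s) * deriv (U e) s * deriv (U e) s +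
    superposition f₁ (U e s) * deriv (deriv (U e)) s
  have hN (e : C0) (s : ℝ) : HasDerivAt (fun s => superposition f (U e s)) (g₁ e s) s :=
    hasDerivAt_superposition_comp hd₁ (hU₁ e s)
  have hg₁ (e : C0) (s : ℝ) : HasDerivAt (g₁ e) (g₂ e s) s :=
    (hasDerivAt_superposition_comp hd₂ (hU₁ e s)).mul (hU₂ e s)
  have heq (e : C0) (s : ℝ) : U e s + meanPrimitive (superposition f (U e s)) = s • 1 + e :=
    hinv (s • 1 + e)
  have heq₁ (e : C0) (s : ℝ) : deriv (U e) s + meanPrimitive (g₁ e s) = 1 := by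
    have a := (hU₁ e s).add (meanPrimitive.hasFDerivAt.comp_hasDerivAt s (hN e s))
    have b : HasDerivAt (fun s : ℝ => s • (1 : C0) + e) 1 s :=
      (((hasDerivAt_id s).smul_const (1 : C0)).add_const e).congr_deriv (one_smul _ _)
    rw [← show (U e + (meanPrimitive ∘ fun s => superposition f (U e s))) =
      fun s : ℝ => s • (1 : C0) + e from funext (heq e)] at b
    exact a.unique b
  have heq₂ (e : C0) (s : ℝ) : deriv (deriv (U e)) s = -meanPrimitive (g₂ e s) := by
    have a := (hU₂ e s).add (meanPrimitive.hasFDerivAt.comp_hasDerivAt s (hg₁ e s))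
    have b : HasDerivAt (fun _ : ℝ => (1 : C0)) 0 s := hasDerivAt_const s 1
    rw [← show (deriv (U e) + (meanPrimitive ∘ g₁ e)) = fun _ : ℝ => (1 : C0) from
      funext (heq₁ e)] at b
    exact eq_neg_of_add_eq_zero_left (a.unique b)
  refine ⟨fun p => mean (g₁ p.2 p.1), fun p => mean (g₂ p.2 p.1),
    fun s e => mean.hasFDerivAt.comp_hasDerivAt s (hN e s),
    fun s e => mean.hasFDerivAt.comp_hasDerivAt s (hg₁ e s), fun s e => ?_⟩
  -- If `mean g₂ ≤ 0`, then `k' = (mean g₂ - f₂ h²) - f₁ k` has nonpositive forcing, strictly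
  -- negative at `0` because `h 0 = 1`, while `k` vanishes at `0` and `1`.
  by_contra! hle
  set h := deriv (U e) s
  have hh0 : h ((0 : ℝ) : UnitAddCircle) = 1 := by
    have := congrArg (fun v : C0 => v ((0 : ℝ) : UnitAddCircle)) (heq₁ e s)
    simp only [ContinuousMap.add_apply, meanPrimitive_zero] at this
    simpa using this
  set k := deriv (deriv (U e)) s
  have hk' : k = -meanPrimitive (g₂ e s) := heq₂ e s
  have hkd (t : ℝ) : HasDerivAt (fun t : ℝ => k t)
      ((mean (g₂ e s) - f₂ (t, U e s t) * h t * h t) - f₁ (t, U e s t) * k t) t := by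
    have hg : g₂ e s t = f₂ (t, U e s t) * h t * h t + f₁ (t, U e s t) * k t := rfl
    have hd := (hasDerivAt_meanPrimitive (g₂ e s) t).neg
    rw [hg] at hd
    rw [hk'] at hd ⊢
    exact hd.congr_deriv (by ring)
  have hc := continuous_coe_comp h
  refine false_of_linear_of_nonpos (a := fun t : ℝ => f₁ (t, U e s t))
    (g := fun t : ℝ => mean (g₂ e s) - f₂ (t, U e s t) * h t * h t)
    (continuous_coe_comp (superposition f₁ (U e s)))
    (continuous_const.sub (((continuous_coe_comp (superposition f₂ (U e s))).mul hc).mul hc))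
    hkd ?_ ?_ (fun t => ?_) ?_
  · rw [hk', ContinuousMap.neg_apply, meanPrimitive_zero, neg_zero]
  · rw [hk', ContinuousMap.neg_apply, meanPrimitive_one, neg_zero]
  · have := mul_nonneg (hf₂ t (U e s t)).le (mul_self_nonneg (h t))
    linarith
  · have := hf₂ ((0 : ℝ) : UnitAddCircle) (U e s ((0 : ℝ) : UnitAddCircle))
    simp only [hh0]
    linarith

theorem UniformlyCoercive.exists_forall_le_height {f : C(UnitAddCircle × ℝ, ℝ)}
    (hf : UniformlyCoercive f) {Ψ : C0 → C0} (hinv : ∀ y, straighten f (Ψ y) = y) (e : C0)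
    (M : ℝ) : ∃ R, ∀ s, R ≤ |s| → M ≤ height f Ψ (s, e) := by
  obtain ⟨R, -, hR⟩ := hf M
  refine ⟨R + ‖e‖, fun s hs => ?_⟩
  obtain ⟨t, ht⟩ := exists_le_mean f (Ψ (s • 1 + e))
  rw [hinv] at ht
  refine (hR t _ ?_).le.trans ht
  have h1 := abs_sub_abs_le_abs_sub s (-e t)
  have h2 := e.norm_coe_le_norm t
  rw [Real.norm_eq_abs] at h2
  rw [abs_neg, sub_neg_eq_add] at h1
  have h3 : (s • 1 + e : C0) t = s + e t := by simp
  rw [h3]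
  linarith

theorem exists_height_fold {f : C(UnitAddCircle × ℝ, ℝ)} (hf : SmoothOnCylinder f)
    (hcoer : UniformlyCoercive f) (hconvex : ∀ t x, 0 < D₂D₂ f t x) {Ψ : C0 → C0}
    (hΨ : ContDiff ℝ ∞ Ψ) (hinv : ∀ y, straighten f (Ψ y) = y) :
    ∃ (m : C0 → ℝ) (ξ σ : ℝ × C0 → ℝ), ContDiff ℝ ∞ m ∧ ContDiff ℝ ∞ ξ ∧ ContDiff ℝ ∞ σ ∧
      (∀ s e, σ (ξ (s, e), e) = s) ∧ (∀ x e, ξ (σ (x, e), e) = x) ∧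
      ∀ s e, height f Ψ (s, e) = ξ (s, e) ^ 2 + m e := by
  obtain ⟨c₁, c₂, h₁, h₂, hpos⟩ := exists_height_derivs hf hconvex hΨ hinv
  refine exists_fold_coordinate (contDiff_height hf hΨ) h₁ h₂ hpos (fun e => ?_) fun e => ?_
  · refine tendsto_atTop.2 fun M => ?_
    obtain ⟨R, hR⟩ := hcoer.exists_forall_le_height hinv e M
    filter_upwards [eventually_ge_atTop R] with s hs
    exact hR s (hs.trans (le_abs_self s))
  · refine tendsto_atTop.2 fun M => ?_
    obtain ⟨R, hR⟩ := hcoer.exists_forall_le_height hinv e M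
    filter_upwards [eventually_le_atBot (-R)] with s hs
    exact hR s (by linarith [neg_abs_le s])

/-! ### Operators which become a fold in linear coordinates -/

theorem isGlobalFold_of_contDiff {B₁ B₀ : Type*} [NormedAddCommGroup B₁] [NormedSpace ℝ B₁]
    [NormedAddCommGroup B₀] [NormedSpace ℝ B₀] {Z : Submodule ℝ B₀} {G : B₁ → B₀}
    (Ξ₁ : B₁ ≃ (ℝ × Z)) (Ξ₀ : B₀ ≃ (ℝ × Z)) (h₁ : ContDiff ℝ ∞ Ξ₁) (h₁' : ContDiff ℝ ∞ Ξ₁.symm)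
    (h₀ : ContDiff ℝ ∞ Ξ₀) (h₀' : ContDiff ℝ ∞ Ξ₀.symm)
    (h : ∀ x v, Ξ₀ (G (Ξ₁.symm (x, v))) = (x ^ 2, v)) : IsGlobalFold Z G :=
  ⟨⟨Ξ₁, h₁.contMDiff, h₁'.contMDiff⟩, ⟨Ξ₀, h₀.contMDiff, h₀'.contMDiff⟩, h⟩

/-- Suppose that in linear coordinates `ℝ × Z` an operator reads
`(s, z) ↦ (∫ f(·, u), z + j (f(·, u)))` with `u = s + κ z`, where `κ ∘ j` is the primitive of mean
free parts. Then it is a global fold. -/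
theorem isGlobalFold_of_coordinates {B₁ B₀ : Type*} [NormedAddCommGroup B₁] [NormedSpace ℝ B₁]
    [NormedAddCommGroup B₀] [NormedSpace ℝ B₀] {Z : Submodule ℝ B₀} {G : B₁ → B₀}
    {f : C(UnitAddCircle × ℝ, ℝ)} (hf : SmoothOnCylinder f) (hcoer : UniformlyCoercive f)
    (hconvex : ∀ t x, 0 < D₂D₂ f t x) (L : B₁ ≃L[ℝ] (ℝ × Z)) (M : B₀ ≃L[ℝ] (ℝ × Z))
    (κ : Z →L[ℝ] C0) (j : C0 →L[ℝ] Z) (hj : ∀ g, κ (j g) = meanPrimitive g)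
    (hG : ∀ s z, M (G (L.symm (s, z))) = (mean (superposition f (s • 1 + κ z)),
      z + j (superposition f (s • 1 + κ z)))) : IsGlobalFold Z G := by
  obtain ⟨Ψ, hΨ, hleft, hright⟩ := exists_straighten_inverse hf hcoer
  obtain ⟨m, ξ, σ, hm, hξ, hσ, hσξ, hξσ, hheight⟩ :=
    exists_height_fold hf hcoer hconvex hΨ hright
  have hN := contDiff_superposition hf
  have hone : ContDiff ℝ ∞ fun p : ℝ × Z => p.1 • (1 : C0) + κ p.2 :=
    (contDiff_fst.smul contDiff_const).add (κ.contDiff.comp contDiff_snd)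
  let N₁ : ℝ × Z → Z := fun p => j (superposition f (p.1 • 1 + κ p.2))
  let N₂ : ℝ × Z → Z := fun p => j (superposition f (Ψ (p.1 • 1 + κ p.2)))
  have hN₁ : ContDiff ℝ ∞ N₁ := j.contDiff.comp (hN.comp hone)
  have hN₂ : ContDiff ℝ ∞ N₂ := j.contDiff.comp (hN.comp (hΨ.comp hone))
  -- `κ` intertwines the change of the second component with `straighten f`. Thus `Ψ` recovers `u`
  -- from the new coordinates and gives an explicit inverse of `Y`, with no inverse function theorem
  -- on `B₁`.
  have hκ₁ (s : ℝ) (z : Z) : s • 1 + κ (z + N₁ (s, z)) = straighten f (s • 1 + κ z) := by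
    simp only [N₁, map_add, hj, straighten, add_assoc]
  have hκ₂ (s : ℝ) (z : Z) : s • 1 + κ (z - N₂ (s, z)) = Ψ (s • 1 + κ z) := by
    simp only [N₂, map_sub, hj]
    rw [← add_sub_assoc, sub_eq_iff_eq_add]
    exact (hright _).symm
  let Y : (ℝ × Z) ≃ (ℝ × Z) :=
    { toFun p := (p.1, p.2 + N₁ p)
      invFun p := (p.1, p.2 - N₂ p)
      left_inv p := by
        have : N₂ (p.1, p.2 + N₁ p) = N₁ p := by
          simp only [N₂]
          rw [show p = (p.1, p.2) from rfl, hκ₁, hleft]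
        simp [this]
      right_inv p := by
        have : N₁ (p.1, p.2 - N₂ p) = N₂ p := by
          simp only [N₁]
          rw [show p = (p.1, p.2) from rfl, hκ₂]
        simp [this] }
  have hY : ContDiff ℝ ∞ Y := contDiff_fst.prodMk (contDiff_snd.add hN₁)
  have hY' : ContDiff ℝ ∞ Y.symm := contDiff_fst.prodMk (contDiff_snd.sub hN₂)
  let X : (ℝ × Z) ≃ (ℝ × Z) :=
    { toFun p := (ξ (p.1, κ p.2), p.2)
      invFun p := (σ (p.1, κ p.2), p.2)
      left_inv p := by simp [hσξ]
      right_inv p := by simp [hξσ] }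
  have hid : ContDiff ℝ ∞ fun p : ℝ × Z => (p.1, κ p.2) :=
    contDiff_fst.prodMk (κ.contDiff.comp contDiff_snd)
  have hX : ContDiff ℝ ∞ X := (hξ.comp hid).prodMk contDiff_snd
  have hX' : ContDiff ℝ ∞ X.symm := (hσ.comp hid).prodMk contDiff_snd
  let H : (ℝ × Z) ≃ (ℝ × Z) :=
    { toFun p := (p.1 - m (κ p.2), p.2)
      invFun p := (p.1 + m (κ p.2), p.2)
      left_inv p := by simp
      right_inv p := by simp }
  have hmκ : ContDiff ℝ ∞ fun p : ℝ × Z => m (κ p.2) :=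
    hm.comp (κ.contDiff.comp contDiff_snd)
  have hH : ContDiff ℝ ∞ H := (contDiff_fst.sub hmκ).prodMk contDiff_snd
  have hH' : ContDiff ℝ ∞ H.symm := (contDiff_fst.add hmκ).prodMk contDiff_snd
  refine isGlobalFold_of_contDiff ((L.toEquiv.trans Y).trans X) (M.toEquiv.trans H)
    (hX.comp (hY.comp L.contDiff)) (L.symm.contDiff.comp (hY'.comp hX'))
    (hH.comp M.contDiff) (M.symm.contDiff.comp hH') fun x z => ?_
  change H (M (G (L.symm (σ (x, κ z), z - N₂ (σ (x, κ z), z))))) = _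
  rw [hG, hκ₂]
  have h1 := hheight (σ (x, κ z)) (κ z)
  rw [hξσ, height] at h1
  simp only [Equiv.coe_fn_mk, H]
  have h2 : j (superposition f (Ψ (σ (x, κ z) • 1 + κ z))) = N₂ (σ (x, κ z), z) := rfl
  rw [h1, h2, sub_add_cancel]
  simp

/-! ### Splitting off the mean value -/

section Split

variable {B : Type*} [NormedAddCommGroup B] [NormedSpace ℝ B] (ℓ : B →L[ℝ] ℝ) (e : B)
  (he : ℓ e = 1) (Z : Submodule ℝ B) (hZ : ∀ v, v ∈ Z ↔ ℓ v = 0)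

/-- The projection `v ↦ v - ℓ v • e` onto the kernel of `ℓ`. -/
def kerProj : B →L[ℝ] Z :=
  (ContinuousLinearMap.id ℝ B - ℓ.smulRight e).codRestrict Z fun v => by simp [hZ, he]

theorem coe_kerProj (v : B) : (kerProj ℓ e he Z hZ v : B) = v - ℓ v • e :=
  rfl

theorem kerProj_coe (z : Z) : kerProj ℓ e he Z hZ z = z := by
  ext
  simp [coe_kerProj, (hZ _).1 z.2]

/-- The decomposition `v ↦ (ℓ v, v - ℓ v • e)`. -/
def kerSplit : B ≃L[ℝ] (ℝ × Z) :=
  .equivOfInverse (ℓ.prod (kerProj ℓ e he Z hZ))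
    ((ContinuousLinearMap.toSpanSingleton ℝ e).coprod Z.subtypeL)
    (fun v => by simp [coe_kerProj]) fun p => by
      ext
      · simp [he, (hZ _).1 p.2.2]
      · simp [coe_kerProj, he, (hZ _).1 p.2.2]

theorem kerSplit_apply (v : B) : kerSplit ℓ e he Z hZ v = (ℓ v, kerProj ℓ e he Z hZ v) :=
  rfl

end Split

theorem mean_one : mean 1 = 1 :=
  mean_const 1

theorem meanPrimitive_const_one : meanPrimitive 1 = 0 := by
  ext x
  obtain ⟨t, -, rfl⟩ := exists_coe_eq x
  rw [meanPrimitive_coe, mean_one]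
  simp

/-! ### Continuously differentiable functions -/

theorem mem_C0Tilde_iff (v : C0) : v ∈ C0Tilde ↔ mean v = 0 := by
  rw [mean_apply]
  rfl

theorem C1.integral_eq (u : C1) (t : ℝ) :
    ∫ s in (0 : ℝ)..t, u.1.2 s = u.1.1 t - u.1.1 ((0 : ℝ) : UnitAddCircle) :=
  intervalIntegral.integral_eq_sub_of_hasDerivAt (fun s _ => u.2 s)
    ((continuous_coe_comp u.1.2).intervalIntegrable _ _)

theorem C1.mean_deriv (u : C1) : mean u.1.2 = 0 := by
  rw [mean_apply, ← intervalIntegral_zero_one, C1.integral_eq, AddCircle.coe_period,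
    ← QuotientAddGroup.mk_zero]
  exact sub_self _

/-- Periodicity makes `u'` mean free, so its corrected primitive is the ordinary one. -/
theorem C1.eq_add_meanPrimitive (u : C1) :
    u.1.1 ((0 : ℝ) : UnitAddCircle) • 1 + meanPrimitive u.1.2 = u.1.1 := by
  ext x
  obtain ⟨t, -, rfl⟩ := exists_coe_eq x
  rw [ContinuousMap.add_apply, meanPrimitive_coe, C1.mean_deriv, C1.integral_eq]
  simp

/-- The coordinates `u ↦ (u(0), u')` on `C¹`. -/
def C1.coordinates : C1 ≃L[ℝ] (ℝ × C0Tilde) :=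
  .equivOfInverse
    (((ContinuousMap.evalCLM ℝ ((0 : ℝ) : UnitAddCircle)) ∘L .fst ℝ C0 C0 ∘L C1.subtypeL).prod
      ((.snd ℝ C0 C0 ∘L C1.subtypeL : C1 →L[ℝ] C0).codRestrict C0Tilde fun u =>
        (mem_C0Tilde_iff _).2 (C1.mean_deriv u)))
    ((((ContinuousLinearMap.toSpanSingleton ℝ (1 : C0)).coprod
        (meanPrimitive ∘L C0Tilde.subtypeL)).prod
      (C0Tilde.subtypeL ∘L .snd ℝ ℝ C0Tilde)).codRestrict C1 fun p t => by
        have h := (hasDerivAt_meanPrimitive (p.2 : C0) t).const_add p.1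
        rw [(mem_C0Tilde_iff _).1 p.2.2, sub_zero] at h
        simpa using! h)
    (fun u => Subtype.ext (Prod.ext (C1.eq_add_meanPrimitive u) rfl))
    fun p => by
      refine Prod.ext ?_ rfl
      change (p.1 • (1 : C0) + meanPrimitive p.2) ((0 : ℝ) : UnitAddCircle) = p.1
      rw [ContinuousMap.add_apply, meanPrimitive_zero]
      simp

theorem isGlobalFold_opC {f : C(UnitAddCircle × ℝ, ℝ)} (hf : SmoothOnCylinder f)
    (hcoer : UniformlyCoercive f) (hconvex : ∀ t x, 0 < D₂D₂ f t x) :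
    IsGlobalFold C0Tilde (opC f) := by
  refine isGlobalFold_of_coordinates hf hcoer hconvex C1.coordinates
    (kerSplit mean 1 mean_one C0Tilde mem_C0Tilde_iff) (meanPrimitive ∘L C0Tilde.subtypeL)
    (kerProj mean 1 mean_one C0Tilde mem_C0Tilde_iff) (fun g => ?_) fun s z => ?_
  · change meanPrimitive (g - mean g • 1) = _
    rw [map_sub, map_smul, meanPrimitive_const_one, smul_zero, sub_zero]
  · have h : opC f (C1.coordinates.symm (s, z)) =
        z + superposition f (s • 1 + (meanPrimitive ∘L C0Tilde.subtypeL) z) := rfl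
    rw [h, kerSplit_apply, map_add, map_add, (mem_C0Tilde_iff _).1 z.2, zero_add, kerProj_coe]

/-! ### The Hilbert space case -/

/-- The inclusion of `L²` into `L¹`. -/
def H0.toL1 : H0 →L[ℝ] Lp ℝ 1 (volume : Measure UnitAddCircle) :=
  LinearMap.mkContinuous
    { toFun v := ((Lp.memLp v).mono_exponent one_le_two).toLp v
      map_add' v w := by
        rw [← MemLp.toLp_add]
        exact MemLp.toLp_congr _ _ (Lp.coeFn_add v w)
      map_smul' c v := by
        rw [RingHom.id_apply, ← MemLp.toLp_const_smul]
        exact MemLp.toLp_congr _ _ (Lp.coeFn_smul c v) } 1 fun v => by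
    have : IsProbabilityMeasure (volume : Measure UnitAddCircle) := ⟨UnitAddCircle.measure_univ⟩
    rw [one_mul]
    change ‖((Lp.memLp v).mono_exponent one_le_two).toLp v‖ ≤ ‖v‖
    rw [Lp.norm_toLp, Lp.norm_def]
    exact ENNReal.toReal_mono (Lp.eLpNorm_ne_top v)
      (eLpNorm_le_eLpNorm_of_exponent_le one_le_two (Lp.aestronglyMeasurable v))

theorem H0.coeFn_toL1 (v : H0) : H0.toL1 v =ᵐ[volume] v :=
  MemLp.coeFn_toLp ((Lp.memLp v).mono_exponent one_le_two)

/-- The inclusion of `C⁰` into `L²`. -/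
def C0.toH0 : C0 →L[ℝ] H0 :=
  ContinuousMap.toLp 2 volume ℝ

theorem C0.coeFn_toH0 (g : C0) : C0.toH0 g =ᵐ[volume] g :=
  ContinuousMap.coeFn_toLp volume g

theorem H0.toL1_toH0 (g : C0) : H0.toL1 (C0.toH0 g) = ContinuousMap.toLp 1 volume ℝ g :=
  Lp.ext ((H0.coeFn_toL1 _).trans ((C0.coeFn_toH0 g).trans
    (ContinuousMap.coeFn_toLp volume g).symm))

/-- The mean value on `L²`. -/
def H0.mean : H0 →L[ℝ] ℝ :=
  L1.integralCLM ∘L H0.toL1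

theorem H0.mean_apply (v : H0) : H0.mean v = ∫ t, v t := by
  rw [H0.mean, ContinuousLinearMap.comp_apply, ← L1.integral_eq, L1.integral_eq_integral]
  exact integral_congr_ae (H0.coeFn_toL1 v)

theorem H0.mean_toH0 (g : C0) : H0.mean (C0.toH0 g) = PeriodicODE.mean g := by
  rw [H0.mean, ContinuousLinearMap.comp_apply, H0.toL1_toH0]
  rfl

theorem mem_H0Tilde_iff (v : H0) : v ∈ H0Tilde ↔ H0.mean v = 0 := by
  rw [H0.mean_apply]
  rfl

/-- The primitive, vanishing at `0`, of the mean free part of a square integrable function. -/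
def H0.primitive : H0 →L[ℝ] C0 :=
  PeriodicODE.primitive ∘L H0.toL1

theorem H0.primitive_toH0 (g : C0) : H0.primitive (C0.toH0 g) = meanPrimitive g := by
  rw [H0.primitive, ContinuousLinearMap.comp_apply, H0.toL1_toH0]
  rfl

theorem H0.primitive_coe (v : H0) {t : ℝ} (ht : t ∈ Set.Icc (0 : ℝ) 1) :
    H0.primitive v t = (∫ s in (0 : ℝ)..t, v s) - t * H0.mean v := by
  rw [H0.primitive, ContinuousLinearMap.comp_apply, primitive_apply, primitiveFun_coe,
    H0.integral_congr (H0.coeFn_toL1 v) ht, integral_congr_ae (H0.coeFn_toL1 v), H0.mean_apply]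

theorem H1.mean_snd (u : H1) : H0.mean u.1.snd = 0 := by
  obtain ⟨U, -, hU⟩ := u.2
  have h := hU 1 (by simp)
  rw [intervalIntegral_zero_one, AddCircle.coe_period, ← QuotientAddGroup.mk_zero,
    left_eq_add] at h
  rw [H0.mean_apply, h]

theorem H1.exists_fst_eq (u : H1) : ∃ a : ℝ, u.1.fst = C0.toH0 (a • 1 + H0.primitive u.1.snd) := by
  obtain ⟨U, hU, hU'⟩ := u.2
  refine ⟨U ((0 : ℝ) : UnitAddCircle), Lp.ext (hU.trans ?_)⟩
  refine EventuallyEq.trans (Eventually.of_forall fun x => ?_) (C0.coeFn_toH0 _).symm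
  obtain ⟨t, ht, rfl⟩ := exists_coe_eq x
  rw [hU' t ht, ContinuousMap.add_apply, H0.primitive_coe _ ht, H1.mean_snd]
  simp

/-- The value at `0` of the continuous representative. -/
def H1.evalZero : WithLp 2 (H0 × H0) →L[ℝ] ℝ :=
  H0.mean ∘L WithLp.fstL 2 ℝ H0 H0 - mean ∘L H0.primitive ∘L WithLp.sndL 2 ℝ H0 H0

/-- Point evaluation is not defined on `L²`, but taking means in `u = a + Q u'` expresses `a`
through quantities continuous in `(u, u')`. -/
theorem H1.evalZero_eq {p : WithLp 2 (H0 × H0)} {a : ℝ}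
    (h : p.fst = C0.toH0 (a • 1 + H0.primitive p.snd)) : H1.evalZero p = a := by
  change H0.mean p.fst - mean (H0.primitive p.snd) = a
  rw [h, H0.mean_toH0, map_add, map_smul, mean_one]
  simp

theorem H1.fst_eq (u : H1) :
    C0.toH0 (H1.evalZero u.1 • 1 + H0.primitive u.1.snd) = u.1.fst := by
  obtain ⟨a, ha⟩ := H1.exists_fst_eq u
  rw [H1.evalZero_eq ha, ← ha]

/-- The element of `H¹` with given value at `0` and given derivative. -/
def H1.ofCoordinates : ℝ × H0Tilde →L[ℝ] WithLp 2 (H0 × H0) :=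
  (WithLp.prodContinuousLinearEquiv 2 ℝ H0 H0).symm.toContinuousLinearMap ∘L
    ((C0.toH0 ∘L ((ContinuousLinearMap.toSpanSingleton ℝ (1 : C0)).coprod
        (H0.primitive ∘L H0Tilde.subtypeL))).prod
      (H0Tilde.subtypeL ∘L .snd ℝ ℝ H0Tilde))

theorem H1.fst_ofCoordinates (p : ℝ × H0Tilde) :
    (H1.ofCoordinates p).fst = C0.toH0 (p.1 • 1 + H0.primitive p.2) :=
  rfl

theorem H1.snd_ofCoordinates (p : ℝ × H0Tilde) : (H1.ofCoordinates p).snd = p.2 :=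
  rfl

theorem H1.ofCoordinates_mem (p : ℝ × H0Tilde) : H1.ofCoordinates p ∈ H1 := by
  refine ⟨p.1 • 1 + H0.primitive p.2, ?_, fun t ht => ?_⟩
  · rw [H1.fst_ofCoordinates]
    exact C0.coeFn_toH0 _
  · rw [ContinuousMap.add_apply, ContinuousMap.add_apply, H0.primitive_coe _ ht,
      H0.primitive_coe _ (by simp), (mem_H0Tilde_iff _).1 p.2.2, H1.snd_ofCoordinates]
    simp

/-- The coordinates `u ↦ (u(0), u')` on `H¹`. -/
def H1.coordinates : H1 ≃L[ℝ] (ℝ × H0Tilde) :=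
  .equivOfInverse
    ((H1.evalZero ∘L H1.subtypeL).prod
      ((WithLp.sndL 2 ℝ H0 H0 ∘L H1.subtypeL : H1 →L[ℝ] H0).codRestrict H0Tilde fun u =>
        (mem_H0Tilde_iff _).2 (H1.mean_snd u)))
    (H1.ofCoordinates.codRestrict H1 H1.ofCoordinates_mem)
    (fun u => Subtype.ext (WithLp.ofLp_injective 2 (Prod.ext (H1.fst_eq u) rfl)))
    fun p => Prod.ext (H1.evalZero_eq (H1.fst_ofCoordinates p)) rfl

/-- The continuous representative may replace the `L²` class inside `f`, so smoothness of
superposition is needed only on `C⁰`. -/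
theorem opH_ofCoordinates (f : C(UnitAddCircle × ℝ, ℝ)) (p : ℝ × H0Tilde) :
    opH f (H1.coordinates.symm p) =
      p.2 + C0.toH0 (superposition f (p.1 • 1 + H0.primitive p.2)) := by
  change (p.2 : H0) + MemLp.toLp _ _ = _
  congr 1
  refine Lp.ext ((MemLp.coeFn_toLp _).trans (EventuallyEq.trans ?_ (C0.coeFn_toH0 _).symm))
  filter_upwards [C0.coeFn_toH0 (p.1 • 1 + H0.primitive p.2)] with t ht
  exact congrArg (fun x => f (t, x)) ht

theorem H0.mean_toH0_one : H0.mean (C0.toH0 1) = 1 := by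
  rw [H0.mean_toH0, mean_one]

theorem isGlobalFold_opH {f : C(UnitAddCircle × ℝ, ℝ)} (hf : SmoothOnCylinder f)
    (hcoer : UniformlyCoercive f) (hconvex : ∀ t x, 0 < D₂D₂ f t x) :
    IsGlobalFold H0Tilde (opH f) := by
  refine isGlobalFold_of_coordinates hf hcoer hconvex H1.coordinates
    (kerSplit H0.mean (C0.toH0 1) H0.mean_toH0_one H0Tilde mem_H0Tilde_iff)
    (H0.primitive ∘L H0Tilde.subtypeL)
    (kerProj H0.mean (C0.toH0 1) H0.mean_toH0_one H0Tilde mem_H0Tilde_iff ∘L C0.toH0)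
    (fun g => ?_) fun s z => ?_
  · change H0.primitive (C0.toH0 g - H0.mean (C0.toH0 g) • C0.toH0 1) = _
    rw [map_sub, map_smul, H0.primitive_toH0, H0.primitive_toH0, meanPrimitive_const_one,
      smul_zero, sub_zero]
  · rw [opH_ofCoordinates, kerSplit_apply, map_add, map_add, (mem_H0Tilde_iff _).1 z.2,
      zero_add, kerProj_coe, H0.mean_toH0]
    rfl

end PeriodicODE

end

theorem theorem4p2 (f : C(UnitAddCircle × ℝ, ℝ))
    (hsmooth : PeriodicODE.SmoothOnCylinder f)
    (hproper : IsProperMap f)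
    (htop : ∀ t : UnitAddCircle, Tendsto (fun x : ℝ => f (t, x)) atTop atTop)
    (hbot : ∀ t : UnitAddCircle, Tendsto (fun x : ℝ => f (t, x)) atBot atTop)
    (hconvex : ∀ (t : UnitAddCircle) (x : ℝ), 0 < PeriodicODE.D₂D₂ f t x) :
    PeriodicODE.IsGlobalFold PeriodicODE.C0Tilde (PeriodicODE.opC f) ∧
      PeriodicODE.IsGlobalFold PeriodicODE.H0Tilde (PeriodicODE.opH f) := by
  have hcoer : PeriodicODE.UniformlyCoercive f := fun M =>
    PeriodicODE.exists_forall_le_of_isProperMap hproper htop hbot M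
  exact ⟨PeriodicODE.isGlobalFold_opC hsmooth hcoer hconvex,
    PeriodicODE.isGlobalFold_opH hsmooth hcoer hconvex⟩
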